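/- Let $\mathcal G$ be a finite set and let $K:\mathcal G\times\mathcal G\to[0,\infty)$ be symmetric and connected: any two vertices are joined by a path $g_0,\dots,g_m$ with $K(g_l,g_{l+1})>0$. Let $W:\mathbb R^d\to\mathbb R$ be Borel measurable, let $\tau>0$, and put $c(x,y)=\frac1{2\tau}|x-y|^2$. Let $\mu,\sigma$ be Borel probability measures on $\mathbb R^d\times\mathcal G$ with finite second moments, absolutely continuous with respect to the product of Lebesgue and counting measure. Write $\mu=\sum_g\mu_g\otimes\delta_g$ and $\sigma=\sum_g\sigma_g\otimes\delta_g$, and denote the Lebesgue densities of $\mu_g,\sigma_g$ by the same symbols. A pair $(\gamma,h)$ is *admissible*, $(\gamma,h)\in ADM(\mu,\sigma)$, if $\gamma=(\gamma_g)_{g\in\mathcal G}$, where each $\gamma_g$ is a positive Borel measure on $\mathbb R^d\times\mathbb R^d$ with first marginal $\mu_g$; $h:\mathbb R^d\times\mathcal G\times\mathcal G\to\mathbb R$ satisfies $h_{gg'}(x)=-h_{g'g}(x)$ and $\sum_{g,g'}\int h_{gg'}^2K(g,g')e^{-W}dx<\infty$; and for every $g$ the function $\sum_{g'}h_{gg'}K(g,g')e^{-W}$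 is integrable and $$\sigma_g=\pi_{2\#}\gamma_g-\tau\sum_{g'}h_{gg'}K(g,g')e^{-W}dx .$$ Its cost is $$C_\tau(\gamma,h)=\sum_g\int|x-y|^2\,\frac{d\gamma_g(x,y)}{2\tau}+\frac\tau4\sum_{g,g'}\int h_{gg'}^2K(g,g')e^{-W}dx ,$$ and the static cost is $\mathcal A(\mu,\sigma)=\inf_{ADM(\mu,\sigma)}C_\tau$, with $\inf\emptyset=+\infty$. A function $\varphi:\mathbb R^d\to\mathbb R$ is $c$-concave if $\varphi(y)=\inf_x\,(c(x,y)-\eta(x))$ for all $y$, for some $\eta:\mathbb R^d\to\mathbb R$. Let $\varphi^c(x)=\inf_y\,(c(x,y)-\varphi(y))\in[-\infty,\infty)$ and $\partial^c_+\varphi=\{(x,y):\varphi^c(x)+\varphi(y)=c(x,y)\}$. Let $\Phi$ be the set of $\varepsilon\in L^2(\mathbb R^d\times\mathcal G)$ with compact support such that $\int\varepsilon(x,g)\,dx=0$ for every $g$ and $\sum_g\varepsilon(x,g)=0$ for a.e. $x$, and let $\Phi^\perp$ be the set of $\varphi\in L^2_{loc}(\mathbb R^d\times\mathcal G)$ such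 that $\int\sum_g\varphi(x,g)\varepsilon(x,g)\,dx=0$ for all $\varepsilon\in\Phi$. **Proposition.** Assume $\mathcal A(\mu,\sigma)<\infty$, let $(\gamma,h)\in ADM(\mu,\sigma)$, and assume that for every $g$ the density of $\mu_g$ and the density $\bar f_g=\sigma_g+\tau\sum_{g'}h_{gg'}K(g,g')e^{-W}$ of $\pi_{2\#}\gamma_g$ are strictly positive a.e. Then the following are equivalent. (i) $C_\tau(\gamma,h)\le C_\tau(\tilde\gamma,\tilde h)$ for all $(\tilde\gamma,\tilde h)\in ADM(\mu,\sigma)$. (ii) There are $\phi,\psi:\mathbb R^d\times\mathcal G\to\mathbb R$ such that (a) for every $g$, $\phi_g=\phi(\cdot,g)$ is $c$-concave and $\gamma_g$ is supported on $\partial^c_+\phi_g$; (b) for a.e. $y$, $\psi(y,g')-\psi(y,g)=h_{gg'}(y)$ for all $g,g'$ with $K(g,g')>0$; (c) $\phi-\psi\in\Phi^\perp$. (iii) There is a single $\varphi:\mathbb R^d\times\mathcal G\to\mathbb R$ such that (a), (b), (c) hold with $\phi=\psi=\varphi$. -/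

import Mathlib

open MeasureTheory

noncomputable section

namespace SemiDiscreteOT

/-- `ℝ^d` with its Euclidean norm. -/
abbrev E (d : ℕ) : Type := EuclideanSpace ℝ (Fin d)

/-- `K` is the weight function of a connected weighted graph with vertex set `G`: it is
nonnegative and symmetric, and any two vertices are joined by a path of edges of positive
weight. -/
structure IsConnectedWeightedGraph {G : Type*} (K : G → G → ℝ) : Prop where
  nonneg : ∀ g g', 0 ≤ K g g'
  symm : ∀ g g', K g g' = K g' g
  connected : ∀ g g', Relation.ReflTransGen (fun a b => 0 < K a b) g g'

/-- Borel probability measures on `ℝ^d × G` with finite second moment. (As `G` is finite, only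
the Euclidean component matters for the moment.) -/
structure IsP2 {d : ℕ} {G : Type*} [MeasurableSpace G] (μ : Measure (E d × G)) : Prop where
  prob : IsProbabilityMeasure μ
  moment : ∫⁻ p, ‖p.1‖ₑ ^ 2 ∂μ < ⊤

/-- The measures `μ_g` on `ℝ^d` in the decomposition `μ = ∑ g, μ_g ⊗ δ_g`. -/
def fiber {d : ℕ} {G : Type*} [MeasurableSpace G] (μ : Measure (E d × G)) (g : G) :
    Measure (E d) :=
  (μ.restrict (Prod.snd ⁻¹' {g})).map Prod.fst

/-- The Lebesgue density of `μ_g` (meaningful when `μ` is absolutely continuous). -/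
def density {d : ℕ} {G : Type*} [MeasurableSpace G] (μ : Measure (E d × G)) (g : G) (x : E d) :
    ℝ :=
  ((fiber μ g).rnDeriv volume x).toReal

/-- The rate `∑ g', h_{g g'}(x) K(g,g') exp(-W(x))` at which mass leaves the vertex `g`
over the point `x`. -/
def outflow {d : ℕ} {G : Type*} [Fintype G] (K : G → G → ℝ) (W : E d → ℝ)
    (h : E d → G → G → ℝ) (g : G) (x : E d) : ℝ :=
  ∑ g', h x g g' * K g g' * Real.exp (-W x)

/-- The pair `(γ, h)` of transport plans and mass exchange map is admissible for `(μ, σ)`: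
the plan `γ_g` has first marginal `μ_g`; `h` is antisymmetric and square integrable against
`K(g,g') exp(-W) dx`; and `σ_g = π₂_# γ_g - τ ∑ g', h_{g g'} K(g,g') exp(-W) dx` as finite
(signed) measures, for every `g`. -/
structure IsAdmissible {d : ℕ} {G : Type*} [Fintype G] [MeasurableSpace G] (K : G → G → ℝ)
    (W : E d → ℝ) (τ : ℝ) (μ σ : Measure (E d × G)) (γ : G → Measure (E d × E d))
    (h : E d → G → G → ℝ) : Prop where
  fst_marginal : ∀ g, (γ g).map Prod.fst = fiber μ g
  antisymm : ∀ x g g', h x g g' = -h x g' g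
  memLp : ∀ g g', MemLp (fun x => h x g g') 2
    (volume.withDensity fun x => ENNReal.ofReal (K g g' * Real.exp (-W x)))
  integrable_outflow : ∀ g, Integrable (outflow K W h g) volume
  snd_marginal : ∀ g (A : Set (E d)), MeasurableSet A →
    (fiber σ g).real A = ((γ g).map Prod.snd).real A - τ * ∫ x in A, outflow K W h g x

/-- The quadratic cost `c(x,y) = |x - y|² / (2τ)`. -/
def quadCost {d : ℕ} (τ : ℝ) (x y : E d) : ℝ :=
  1 / (2 * τ) * ‖x - y‖ ^ 2

/-- The cost of a pair `(γ, h)`: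
`∑ g, ∫∫ |x-y|²/(2τ) dγ_g + ∑ g g', (τ/4) ∫ h_{g g'}² K(g,g') exp(-W) dx`. -/
def pairCost {d : ℕ} {G : Type*} [Fintype G] (K : G → G → ℝ) (W : E d → ℝ) (τ : ℝ)
    (γ : G → Measure (E d × E d)) (h : E d → G → G → ℝ) : ENNReal :=
  (∑ g, ∫⁻ p, ENNReal.ofReal (quadCost τ p.1 p.2) ∂(γ g)) +
    (∑ g, ∑ g', ∫⁻ x, ENNReal.ofReal (τ / 4 * (h x g g' ^ 2 * K g g' * Real.exp (-W x))))

/-- The static semi-discrete transport cost between `μ` and `σ` (infinite if no pair is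
admissible). -/
def staticCost {d : ℕ} {G : Type*} [Fintype G] [MeasurableSpace G] (K : G → G → ℝ)
    (W : E d → ℝ) (τ : ℝ) (μ σ : Measure (E d × G)) : ENNReal :=
  ⨅ (γ : G → Measure (E d × E d)) (h : E d → G → G → ℝ) (_ : IsAdmissible K W τ μ σ γ h),
    pairCost K W τ γ h

/-- The density `f̄_g = σ_g + τ ∑ g', h_{g g'} K(g,g') exp(-W)` of `π₂_# γ_g`. -/
def transportedDensity {d : ℕ} {G : Type*} [Fintype G] [MeasurableSpace G] (K : G → G → ℝ)
    (W : E d → ℝ) (τ : ℝ) (σ : Measure (E d × G)) (h : E d → G → G → ℝ) (g : G) (x : E d) : ℝ :=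
  density σ g x + τ * outflow K W h g x

/-- `φ` is `c`-concave: `φ(y) = inf_x (c(x,y) - ψ(x))` for some real-valued `ψ`. The infimum is
taken in the extended reals, so it has to be finite. -/
def IsCConcave {X : Type*} (c : X → X → ℝ) (φ : X → ℝ) : Prop :=
  ∃ ψ : X → ℝ, ∀ y, (φ y : EReal) = ⨅ x, ((c x y - ψ x : ℝ) : EReal)

/-- The `c`-transform `φ^c(x) = inf_y (c(x,y) - φ(y))`, with values in the extended reals. -/
def cTransform {X : Type*} (c : X → X → ℝ) (φ : X → ℝ) (x : X) : EReal :=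
  ⨅ y, ((c x y - φ y : ℝ) : EReal)

/-- The `c`-superdifferential `{(x,y) | φ^c(x) + φ(y) = c(x,y)}`. -/
def cSuperdiff {X : Type*} (c : X → X → ℝ) (φ : X → ℝ) : Set (X × X) :=
  {p | cTransform c φ p.1 + (φ p.2 : EReal) = (c p.1 p.2 : EReal)}

/-- The space `Φ` of compactly supported square integrable functions on `ℝ^d × G` with
`∫ ε(x,g) dx = 0` for all `g` and `∑ g, ε(x,g) = 0` for almost every `x`. -/
def Phi (d : ℕ) (G : Type*) [Fintype G] : Set (E d → G → ℝ) :=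
  {ε | (∀ g, MemLp (fun x => ε x g) 2 volume) ∧
    (∃ R : ℝ, ∀ g, ∀ᵐ x, R ≤ ‖x‖ → ε x g = 0) ∧
    (∀ g, ∫ x, ε x g = 0) ∧
    ∀ᵐ x, ∑ g, ε x g = 0}

/-- The space `Φ^⊥` of locally square integrable functions on `ℝ^d × G` that are orthogonal
to `Φ`. -/
def PhiPerp (d : ℕ) (G : Type*) [Fintype G] : Set (E d → G → ℝ) :=
  {φ | (∀ g, ∀ S : Set (E d), IsCompact S → MemLp (fun x => φ x g) 2 (volume.restrict S)) ∧
    ∀ ε ∈ Phi d G, ∫ x, ∑ g, φ x g * ε x g = 0}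

/-- The three properties of a pair of potentials `(φ, ψ)` relative to a pair `(γ, h)`:
each `φ_g` is `c`-concave and `γ_g` is supported on its `c`-superdifferential; the discrete
gradient of `ψ` is `h` along the edges, almost everywhere; and `φ - ψ ∈ Φ^⊥`. -/
structure ArePotentials {d : ℕ} {G : Type*} [Fintype G] (K : G → G → ℝ) (τ : ℝ)
    (γ : G → Measure (E d × E d)) (h : E d → G → G → ℝ) (φ ψ : E d → G → ℝ) : Prop where
  cConcave : ∀ g, IsCConcave (quadCost τ) (fun y => φ y g)
  supported : ∀ g, (γ g) (cSuperdiff (quadCost τ) (fun y => φ y g))ᶜ = 0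
  gradient : ∀ᵐ y, ∀ g g', 0 < K g g' → ψ y g' - ψ y g = h y g g'
  perp : φ - ψ ∈ PhiPerp d G

end SemiDiscreteOT

end

noncomputable section

namespace SemiDiscreteOT

/-! ### Fibres over the vertices and their Lebesgue densities. -/

section Basics

variable {d : ℕ} {G : Type*} [MeasurableSpace G]

/-! The statement couples Kantorovich duality on each layer with the Euler-Lagrange equation of a
quadratic energy on the graph.

Potentials certify optimality (`ArePotentials.realCost_le`). On the support of `γ_g` the cost splits
as `φ_g^c(x) + φ_g(y)`, while every competitor plan costs at least this. The two second marginals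
differ by `τ` times the outflow of `h' - h`. Summation by parts on the graph (`sum_mul_outflow`)
therefore turns the integral of `φ` against this difference into the pairing of `h' - h` with the
discrete gradient of `φ`, which is `h`. Convexity of the square concludes. Since outflows cancel in
the sum over `g`, all competitors have the same total second marginal, hence finite second moments
and finite cost.

Two potentials merge into one because testing `Φ^⊥` against `η(x)(1_a - 1_b)` shows that the
components of `φ - ψ` differ by constants (`exists_sub_ae_eq_const_of_mem_phiPerp`). Shifting each
`φ_g` by its constant preserves `c`-concavity and the superdifferential, and gives it the gradient
of `ψ`.

Optimality produces potentials through cyclical monotonicity with jumps between layers. Small pieces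
of the plans near points `(x_i, y_i)` in layers `g_i` have their second marginals permuted
cyclically. If the new target lies in an adjacent layer, the imbalance is repaired by altering `h`
on that edge (`Rearrangement`). The first variation, localized at the points, yields
`cyclic_nonneg`: the sum of `c(x_i, y_{i+1}) - c(x_i, y_i) + h_{g_i g_{i+1}}(y_{i+1})` around a
cycle is nonnegative. Without negative cycles, shortest path lengths give a function `D` on the good
points (`exists_feasible_potential`). Edges inside a layer make `D` the values of a `c`-concave
function (`exists_cConcave_of_feasible`), and edges between layers over one `y` give the gradient
condition. Strict positivity of the densities makes the good points project onto conull sets, which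
keeps all the infima finite. -/

lemma fiber_apply [MeasurableSingletonClass G] (μ : Measure (E d × G)) (g : G) {A : Set (E d)}
    (hA : MeasurableSet A) : fiber μ g A = μ (A ×ˢ {g}) := by
  rw [fiber, Measure.map_apply measurable_fst hA, Measure.restrict_apply (measurable_fst hA)]
  rfl

lemma isFiniteMeasure_fiber (μ : Measure (E d × G)) [IsFiniteMeasure μ] (g : G) :
    IsFiniteMeasure (fiber μ g) := by
  unfold fiber; infer_instance

lemma lintegral_fiber_lt_top {μ : Measure (E d × G)} (hμ : IsP2 μ) (g : G) :
    ∫⁻ x, ‖x‖ₑ ^ 2 ∂(fiber μ g) < ⊤ := by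
  rw [fiber, lintegral_map (by fun_prop) measurable_fst]
  exact (setLIntegral_le_lintegral _ _).trans_lt hμ.moment

lemma fiber_absolutelyContinuous [MeasurableSingletonClass G] [SFinite (Measure.count : Measure G)]
    {μ : Measure (E d × G)}
    (hac : μ ≪ (volume : Measure (E d)).prod Measure.count) (g : G) :
    fiber μ g ≪ volume := by
  refine Measure.AbsolutelyContinuous.mk fun A hA h0 => ?_
  rw [fiber_apply μ g hA]
  apply hac
  rw [Measure.prod_prod, h0, zero_mul]

lemma density_nonneg (μ : Measure (E d × G)) (g : G) (x : E d) : 0 ≤ density μ g x :=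
  ENNReal.toReal_nonneg

lemma measurable_density (μ : Measure (E d × G)) (g : G) : Measurable (density μ g) :=
  (Measure.measurable_rnDeriv _ _).ennreal_toReal

lemma withDensity_density {μ : Measure (E d × G)} [IsFiniteMeasure μ] {g : G}
    (hac : fiber μ g ≪ volume) :
    volume.withDensity (fun x => ENNReal.ofReal (density μ g x)) = fiber μ g := by
  have := isFiniteMeasure_fiber μ g
  rw [← Measure.withDensity_rnDeriv_eq (fiber μ g) volume hac]
  refine withDensity_congr_ae ?_
  have e : ∀ x, density μ g x = ((fiber μ g).rnDeriv volume x).toReal := fun _ => rfl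
  filter_upwards [Measure.rnDeriv_ne_top (fiber μ g) volume] with x hx
  rw [e, ENNReal.ofReal_toReal hx]

lemma integrable_density {μ : Measure (E d × G)} [IsFiniteMeasure μ] {g : G} :
    Integrable (density μ g) volume := by
  have := isFiniteMeasure_fiber μ g
  exact Measure.integrable_toReal_rnDeriv

end Basics

/-! ### Summation by parts on the graph and weighted square integrability. -/

section Exchange

variable {d : ℕ} {G : Type*} [Fintype G] {K : G → G → ℝ} {W : E d → ℝ}

/-- Discrete integration by parts: exchanging the two summation indices flips the sign, and
averaging both forms produces the factor `1/2`. -/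
lemma sum_sum_antisymm {G : Type*} [Fintype G] {a : G → G → ℝ} (ha : ∀ g g', a g g' = -a g' g)
    (φ : G → ℝ) :
    ∑ g, φ g * ∑ g', a g g' = -(1 / 2) * ∑ g, ∑ g', (φ g' - φ g) * a g g' := by
  have h1 : ∑ g, ∑ g', φ g' * a g g' = -∑ g, ∑ g', φ g * a g g' := by
    rw [Finset.sum_comm, ← Finset.sum_neg_distrib]
    refine Finset.sum_congr rfl fun g _ => ?_
    rw [← Finset.sum_neg_distrib]
    refine Finset.sum_congr rfl fun g' _ => ?_
    rw [ha g' g]; ring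
  simp only [sub_mul, Finset.sum_sub_distrib, h1, Finset.mul_sum]
  simp only [← Finset.mul_sum]
  ring

lemma sum_mul_outflow (hK : ∀ g g', K g g' = K g' g) {h : E d → G → G → ℝ}
    (hh : ∀ x g g', h x g g' = -h x g' g) (φ : G → ℝ) (x : E d) :
    ∑ g, φ g * outflow K W h g x =
      -(1 / 2) * ∑ g, ∑ g', (φ g' - φ g) * h x g g' * K g g' * Real.exp (-W x) := by
  have := sum_sum_antisymm (a := fun g g' => h x g g' * K g g' * Real.exp (-W x))
    (fun g g' => by rw [hh x g g', hK g g']; ring) φ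
  simp only [mul_assoc] at this
  simp only [outflow, mul_assoc, this]

lemma sum_outflow (hK : ∀ g g', K g g' = K g' g) {h : E d → G → G → ℝ}
    (hh : ∀ x g g', h x g g' = -h x g' g) (x : E d) :
    ∑ g, outflow K W h g x = 0 := by
  simpa using sum_mul_outflow (W := W) hK hh (fun _ => 1) x

lemma integrable_mul_of_memLp (hW : Measurable W) {κ : ℝ} (hκ : 0 ≤ κ) {f k : E d → ℝ}
    (hf : MemLp f 2 (volume.withDensity fun x => ENNReal.ofReal (κ * Real.exp (-W x))))
    (hk : MemLp k 2 (volume.withDensity fun x => ENNReal.ofReal (κ * Real.exp (-W x)))) :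
    Integrable (fun x => f x * k x * κ * Real.exp (-W x)) volume := by
  have h1 := MemLp.integrable_mul hf hk
  rw [integrable_withDensity_iff_integrable_smul' (by fun_prop) (by simp)] at h1
  refine h1.congr (Filter.Eventually.of_forall fun x => ?_)
  simp only [Pi.mul_apply, smul_eq_mul]
  rw [ENNReal.toReal_ofReal (mul_nonneg hκ (Real.exp_nonneg _))]
  ring

end Exchange

/-! ### Moments, finite costs and second marginals of admissible pairs. -/

section Admissible

variable {d : ℕ} {G : Type*} [Fintype G] [MeasurableSpace G] {K : G → G → ℝ}
  {W : E d → ℝ} {τ : ℝ} {μ σ : Measure (E d × G)} {γ : G → Measure (E d × E d)}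
  {h : E d → G → G → ℝ}

lemma IsAdmissible.isFiniteMeasure [IsFiniteMeasure μ] (hadm : IsAdmissible K W τ μ σ γ h)
    (g : G) : IsFiniteMeasure (γ g) := by
  have := isFiniteMeasure_fiber μ g
  have h1 := hadm.fst_marginal g
  refine ⟨?_⟩
  have : (γ g).map Prod.fst Set.univ = γ g Set.univ := by
    rw [Measure.map_apply measurable_fst MeasurableSet.univ, Set.preimage_univ]
  rw [← this, h1]
  exact measure_lt_top _ _

/-- Exchange only moves mass between vertices over a fixed point, so it disappears in the sum over
the vertices. This is what bounds the second moments of every competitor by those of `σ`. -/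
lemma IsAdmissible.sum_map_snd (hK : IsConnectedWeightedGraph K) [IsFiniteMeasure μ]
    [IsFiniteMeasure σ] (hadm : IsAdmissible K W τ μ σ γ h) :
    ∑ g, (γ g).map Prod.snd = ∑ g, fiber σ g := by
  have := fun g => hadm.isFiniteMeasure g
  have := fun g => isFiniteMeasure_fiber σ g
  ext A hA
  rw [← ENNReal.toReal_eq_toReal_iff' (measure_ne_top _ _) (measure_ne_top _ _)]
  simp only [Measure.finsetSum_apply]
  rw [ENNReal.toReal_sum (fun g _ => measure_ne_top _ _),
    ENNReal.toReal_sum (fun g _ => measure_ne_top _ _)]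
  have h2 : ∑ g, (fiber σ g).real A = ∑ g, ((γ g).map Prod.snd).real A
      - τ * ∑ g, ∫ x in A, outflow K W h g x := by
    rw [Finset.mul_sum, ← Finset.sum_sub_distrib]
    exact Finset.sum_congr rfl fun g _ => hadm.snd_marginal g A hA
  rw [← integral_finsetSum _ (fun g _ => (hadm.integrable_outflow g).integrableOn)] at h2
  simp only [sum_outflow hK.symm hadm.antisymm, integral_zero, mul_zero, sub_zero] at h2
  exact h2.symm

lemma IsAdmissible.lintegral_snd_lt_top (hK : IsConnectedWeightedGraph K) [IsFiniteMeasure μ]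
    (hσ : IsP2 σ) (hadm : IsAdmissible K W τ μ σ γ h) (g : G) :
    ∫⁻ p, ‖p.2‖ₑ ^ 2 ∂(γ g) < ⊤ := by
  have := hσ.prob
  have h1 : ∫⁻ p, ‖p.2‖ₑ ^ 2 ∂(γ g) = ∫⁻ y, ‖y‖ₑ ^ 2 ∂((γ g).map Prod.snd) := by
    rw [lintegral_map (by fun_prop) measurable_snd]
  have h2 : (γ g).map Prod.snd ≤ ∑ g, (γ g).map Prod.snd := by
    intro A
    simp only [Measure.finsetSum_apply]
    exact Finset.single_le_sum (f := fun g => (γ g).map Prod.snd A) (fun _ _ => zero_le)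
      (Finset.mem_univ g)
  rw [h1]
  refine (lintegral_mono' h2 le_rfl).trans_lt ?_
  rw [hadm.sum_map_snd hK, lintegral_finsetSum_measure]
  exact ENNReal.sum_lt_top.2 fun g _ => lintegral_fiber_lt_top hσ g

lemma IsAdmissible.lintegral_fst_lt_top (hμ : IsP2 μ) (hadm : IsAdmissible K W τ μ σ γ h)
    (g : G) : ∫⁻ p, ‖p.1‖ₑ ^ 2 ∂(γ g) < ⊤ := by
  have h1 : ∫⁻ p, ‖p.1‖ₑ ^ 2 ∂(γ g) = ∫⁻ y, ‖y‖ₑ ^ 2 ∂((γ g).map Prod.fst) := by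
    rw [lintegral_map (by fun_prop) measurable_fst]
  rw [h1, hadm.fst_marginal]
  exact lintegral_fiber_lt_top hμ g

lemma integrable_norm_sq_of_lintegral {α : Type*} [MeasurableSpace α] {ν : Measure α}
    {f : α → E d} (hf : Measurable f) (h : ∫⁻ p, ‖f p‖ₑ ^ 2 ∂ν < ⊤) :
    Integrable (fun p => ‖f p‖ ^ 2) ν := by
  refine ⟨by fun_prop, ?_⟩
  rw [hasFiniteIntegral_iff_enorm]
  simpa using h

lemma IsAdmissible.integrable_fst_sq (hμ : IsP2 μ) (hadm : IsAdmissible K W τ μ σ γ h)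
    (g : G) : Integrable (fun p : E d × E d => ‖p.1‖ ^ 2) (γ g) :=
  integrable_norm_sq_of_lintegral measurable_fst (hadm.lintegral_fst_lt_top hμ g)

lemma IsAdmissible.integrable_snd_sq (hK : IsConnectedWeightedGraph K) [IsFiniteMeasure μ]
    (hσ : IsP2 σ) (hadm : IsAdmissible K W τ μ σ γ h) (g : G) :
    Integrable (fun p : E d × E d => ‖p.2‖ ^ 2) (γ g) :=
  integrable_norm_sq_of_lintegral measurable_snd (hadm.lintegral_snd_lt_top hK hσ g)

lemma quadCost_nonneg (hτ : 0 < τ) (x y : E d) : 0 ≤ quadCost τ x y := by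
  unfold quadCost; positivity

@[fun_prop]
lemma continuous_quadCost (τ : ℝ) : Continuous fun p : E d × E d => quadCost τ p.1 p.2 := by
  unfold quadCost; fun_prop

lemma quadCost_le (hτ : 0 < τ) (x y : E d) :
    quadCost τ x y ≤ 1 / τ * (‖x‖ ^ 2 + ‖y‖ ^ 2) := by
  unfold quadCost
  have h1 : ‖x - y‖ ^ 2 ≤ 2 * (‖x‖ ^ 2 + ‖y‖ ^ 2) := by
    nlinarith [parallelogram_law_with_norm ℝ x y, norm_nonneg (x + y)]
  calc 1 / (2 * τ) * ‖x - y‖ ^ 2 ≤ 1 / (2 * τ) * (2 * (‖x‖ ^ 2 + ‖y‖ ^ 2)) := by gcongr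
    _ = _ := by field_simp

lemma IsAdmissible.integrable_cost (hK : IsConnectedWeightedGraph K) (hτ : 0 < τ) (hμ : IsP2 μ)
    (hσ : IsP2 σ) (hadm : IsAdmissible K W τ μ σ γ h) (g : G) :
    Integrable (fun p : E d × E d => quadCost τ p.1 p.2) (γ g) := by
  have := hμ.prob
  refine (((hadm.integrable_fst_sq hμ g).add (hadm.integrable_snd_sq hK hσ g)).const_mul
    (1 / τ)).mono' (by fun_prop) (Filter.Eventually.of_forall fun p => ?_)
  rw [Real.norm_of_nonneg (quadCost_nonneg hτ _ _)]
  exact quadCost_le hτ _ _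

/-- The cost of a pair as a real number. -/
def realCost {d : ℕ} {G : Type*} [Fintype G] (K : G → G → ℝ) (W : E d → ℝ) (τ : ℝ)
    (γ : G → Measure (E d × E d)) (h : E d → G → G → ℝ) : ℝ :=
  (∑ g, ∫ p, quadCost τ p.1 p.2 ∂(γ g)) +
    (∑ g, ∑ g', ∫ x, τ / 4 * (h x g g' ^ 2 * K g g' * Real.exp (-W x)))

lemma IsAdmissible.integrable_energy (hK : IsConnectedWeightedGraph K) (hW : Measurable W)
    (hadm : IsAdmissible K W τ μ σ γ h) (g g' : G) :
    Integrable (fun x => h x g g' ^ 2 * K g g' * Real.exp (-W x)) volume := by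
  simpa [sq] using integrable_mul_of_memLp hW (hK.nonneg g g') (hadm.memLp g g')
    (hadm.memLp g g')

/-- The moment bounds and the square integrability of `h` make both parts finite, so optimality can
be treated with real integrals, where subtraction is harmless. -/
lemma IsAdmissible.pairCost_eq (hK : IsConnectedWeightedGraph K) (hW : Measurable W)
    (hτ : 0 < τ) (hμ : IsP2 μ) (hσ : IsP2 σ) (hadm : IsAdmissible K W τ μ σ γ h) :
    pairCost K W τ γ h = ENNReal.ofReal (realCost K W τ γ h) := by
  have e0 : ∀ g g' x, 0 ≤ τ / 4 * (h x g g' ^ 2 * K g g' * Real.exp (-W x)) := fun g g' x => by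
    have := hK.nonneg g g'
    positivity
  have c0 : ∀ g, 0 ≤ ∫ p, quadCost τ p.1 p.2 ∂(γ g) := fun g =>
    integral_nonneg fun p => quadCost_nonneg hτ _ _
  have i0 : ∀ g g', 0 ≤ ∫ x, τ / 4 * (h x g g' ^ 2 * K g g' * Real.exp (-W x)) := fun g g' =>
    integral_nonneg fun x => e0 g g' x
  rw [pairCost, realCost, ENNReal.ofReal_add (Finset.sum_nonneg fun g _ => c0 g)
    (Finset.sum_nonneg fun g _ => Finset.sum_nonneg fun g' _ => i0 g g'),
    ENNReal.ofReal_sum_of_nonneg fun g _ => c0 g,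
    ENNReal.ofReal_sum_of_nonneg fun g _ => Finset.sum_nonneg fun g' _ => i0 g g']
  congr 1
  · refine Finset.sum_congr rfl fun g _ => ?_
    rw [ofReal_integral_eq_lintegral_ofReal (hadm.integrable_cost hK hτ hμ hσ g)
      (Filter.Eventually.of_forall fun p => quadCost_nonneg hτ _ _)]
  · refine Finset.sum_congr rfl fun g _ => ?_
    rw [ENNReal.ofReal_sum_of_nonneg fun g' _ => i0 g g']
    refine Finset.sum_congr rfl fun g' _ => ?_
    rw [ofReal_integral_eq_lintegral_ofReal ((hadm.integrable_energy hK hW g g').const_mul _)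
      (Filter.Eventually.of_forall fun x => e0 g g' x)]

lemma realCost_nonneg {d : ℕ} {G : Type*} [Fintype G] {K : G → G → ℝ} {W : E d → ℝ} {τ : ℝ}
    {γ : G → Measure (E d × E d)} {h : E d → G → G → ℝ} (hK : IsConnectedWeightedGraph K) (hτ : 0 < τ) :
    0 ≤ realCost K W τ γ h := by
  refine add_nonneg (Finset.sum_nonneg fun g _ => integral_nonneg fun p => quadCost_nonneg hτ _ _)
    (Finset.sum_nonneg fun g _ => Finset.sum_nonneg fun g' _ => integral_nonneg fun x => ?_)
  have := hK.nonneg g g'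
  positivity

lemma integrable_transportedDensity [IsFiniteMeasure σ] (hadm : IsAdmissible K W τ μ σ γ h)
    (g : G) : Integrable (transportedDensity K W τ σ h g) volume :=
  integrable_density.add ((hadm.integrable_outflow g).const_mul τ)

lemma IsAdmissible.real_map_snd [IsFiniteMeasure σ] (hadm : IsAdmissible K W τ μ σ γ h) {g : G}
    (hac : fiber σ g ≪ volume) {A : Set (E d)} (hA : MeasurableSet A) :
    ((γ g).map Prod.snd).real A = ∫ x in A, transportedDensity K W τ σ h g x := by
  have h1 := hadm.snd_marginal g A hA
  have h2 : (fiber σ g).real A = ∫ x in A, density σ g x := by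
    rw [← withDensity_density hac, measureReal_def, withDensity_apply _ hA,
      integral_eq_lintegral_of_nonneg_ae
        (Filter.Eventually.of_forall fun x => density_nonneg σ g x)
        (measurable_density σ g).aestronglyMeasurable]
  unfold transportedDensity
  rw [integral_add integrable_density.integrableOn
    ((hadm.integrable_outflow g).const_mul τ).integrableOn, integral_const_mul, ← h2, h1]
  ring

lemma IsAdmissible.transportedDensity_nonneg [IsFiniteMeasure σ]
    (hadm : IsAdmissible K W τ μ σ γ h) {g : G} (hac : fiber σ g ≪ volume) :
    ∀ᵐ x, 0 ≤ transportedDensity K W τ σ h g x := by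
  refine ae_nonneg_of_forall_setIntegral_nonneg (integrable_transportedDensity hadm g) ?_
  intro A hA _
  rw [← hadm.real_map_snd hac hA]
  exact measureReal_nonneg

lemma IsAdmissible.map_snd_eq [IsFiniteMeasure μ] [IsFiniteMeasure σ]
    (hadm : IsAdmissible K W τ μ σ γ h) {g : G} (hac : fiber σ g ≪ volume) :
    (γ g).map Prod.snd =
      volume.withDensity fun x => ENNReal.ofReal (transportedDensity K W τ σ h g x) := by
  have := hadm.isFiniteMeasure g
  ext A hA
  rw [withDensity_apply _ hA, ← ofReal_integral_eq_lintegral_ofReal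
    (integrable_transportedDensity hadm g).integrableOn
    (ae_restrict_of_ae (hadm.transportedDensity_nonneg hac)), ← hadm.real_map_snd hac hA,
    ofReal_measureReal]

end Admissible

/-! ### The `c`-superdifferential and `c`-concavity as real inequalities. -/

section CConcave

variable {X : Type*} {c : X → X → ℝ} {φ : X → ℝ}

lemma cTransform_eq_of_forall {x y : X} (h : ∀ y', c x y - φ y ≤ c x y' - φ y') :
    cTransform c φ x = ((c x y - φ y : ℝ) : EReal) :=
  le_antisymm (iInf_le _ y) (le_iInf fun y' => EReal.coe_le_coe_iff.2 (h y'))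

/-- Membership says that the infimum defining the `c`-transform at `p.1` is attained at `p.2`; in
this form no extended real appears. -/
lemma mem_cSuperdiff_iff {p : X × X} :
    p ∈ cSuperdiff c φ ↔ ∀ y', c p.1 p.2 - φ p.2 ≤ c p.1 y' - φ y' := by
  constructor
  · intro hp y'
    have hp' : cTransform c φ p.1 + (φ p.2 : EReal) = (c p.1 p.2 : EReal) := hp
    have h1 : cTransform c φ p.1 ≤ ((c p.1 y' - φ y' : ℝ) : EReal) := iInf_le _ y'
    have h2 : (c p.1 p.2 : EReal) ≤ ((c p.1 y' - φ y' : ℝ) : EReal) + (φ p.2 : EReal) := by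
      rw [← hp']; gcongr
    rw [← EReal.coe_add, EReal.coe_le_coe_iff] at h2
    linarith
  · intro h
    change cTransform c φ p.1 + (φ p.2 : EReal) = (c p.1 p.2 : EReal)
    rw [cTransform_eq_of_forall h, ← EReal.coe_add]
    congr 1; ring

lemma cSuperdiff_sub_const (b : ℝ) :
    cSuperdiff c (fun y => φ y - b) = cSuperdiff c φ := by
  ext p
  simp only [mem_cSuperdiff_iff]
  refine forall_congr' fun y' => ?_
  constructor <;> intro h <;> linarith

lemma iInf_coe_eq_coe_iff {ι : Type*} {f : ι → ℝ} {a : ℝ} :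
    (a : EReal) = ⨅ i, (f i : EReal) ↔
      (∀ i, a ≤ f i) ∧ ∀ b : ℝ, (∀ i, b ≤ f i) → b ≤ a := by
  constructor
  · intro h
    refine ⟨fun i => ?_, fun b hb => ?_⟩
    · rw [← EReal.coe_le_coe_iff, h]; exact iInf_le _ i
    · rw [← EReal.coe_le_coe_iff, h]; exact le_iInf fun i => EReal.coe_le_coe_iff.2 (hb i)
  · rintro ⟨h1, h2⟩
    refine le_antisymm (le_iInf fun i => EReal.coe_le_coe_iff.2 (h1 i)) ?_
    refine EReal.le_of_forall_lt_iff_le.1 fun z hz => ?_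
    by_contra hcon
    push Not at hcon
    have : z ≤ a := h2 z fun i => EReal.coe_le_coe_iff.1 (hcon.le.trans (iInf_le _ i))
    exact absurd hz (not_lt.2 (EReal.coe_le_coe_iff.2 this))

lemma IsCConcave.sub_const (h : IsCConcave c φ) (b : ℝ) : IsCConcave c (fun y => φ y - b) := by
  obtain ⟨η, hη⟩ := h
  refine ⟨fun x => η x + b, fun y => ?_⟩
  have := hη y
  rw [iInf_coe_eq_coe_iff] at this ⊢
  refine ⟨fun i => by linarith [this.1 i], fun b' hb' => ?_⟩
  have := this.2 (b' + b) fun i => by linarith [hb' i]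
  linarith

end CConcave

/-! ### Orthogonality to `Φ` forces constant differences. -/

section Perp

variable {d : ℕ} {G : Type*} [Fintype G]

/-- On each ball, the deviation of `v` from its mean is itself an admissible test function, and
testing with it shows that its square integral vanishes. The constants on the balls agree because
the balls are nested. -/
lemma exists_ae_eq_const_of_forall_integral_mul_eq_zero {v : E d → ℝ}
    (hv : ∀ S : Set (E d), IsCompact S → MemLp v 2 (volume.restrict S))
    (h0 : ∀ η : E d → ℝ, MemLp η 2 volume → (∃ R : ℝ, ∀ x, R ≤ ‖x‖ → η x = 0) →
      ∫ x, η x = 0 → ∫ x, v x * η x = 0) :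
    ∃ b : ℝ, ∀ᵐ x, v x = b := by
  let B : ℕ → Set (E d) := fun n => Metric.closedBall 0 (n + 1)
  have hBm : ∀ n, MeasurableSet (B n) := fun n => Metric.isClosed_closedBall.measurableSet
  have hBfin : ∀ n, volume (B n) ≠ ⊤ := fun n => measure_closedBall_lt_top.ne
  have hBpos : ∀ n, volume (B n) ≠ 0 := fun n =>
    (Metric.measure_closedBall_pos volume _ (by positivity)).ne'
  have key : ∀ n, ∃ b : ℝ, ∀ᵐ x ∂(volume.restrict (B n)), v x = b := by
    intro n
    have hfin : IsFiniteMeasure (volume.restrict (B n)) :=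
      ⟨by simpa using (hBfin n).lt_top⟩
    have hv2 := hv (B n) (isCompact_closedBall _ _)
    have hvi : Integrable v (volume.restrict (B n)) := hv2.integrable (by norm_num)
    let b := ⨍ x in B n, v x
    have hb2 : MemLp (fun x => v x - b) 2 (volume.restrict (B n)) := hv2.sub (memLp_const b)
    let η : E d → ℝ := (B n).indicator fun x => v x - b
    have hη : MemLp η 2 volume := (memLp_indicator_iff_restrict (hBm n)).2 hb2
    have hint : ∫ x in B n, (v x - b) = 0 := by
      rw [integral_sub hvi (integrable_const b), integral_const, smul_eq_mul,
        measureReal_restrict_apply_univ]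
      have h1 : b = (volume.real (B n))⁻¹ • ∫ x in B n, v x := setAverage_eq _ _ _
      have h2 : volume.real (B n) ≠ 0 := by
        simp [measureReal_def, ENNReal.toReal_eq_zero_iff, hBpos n, hBfin n]
      rw [h1, smul_eq_mul, mul_inv_cancel_left₀ h2, sub_self]
    have hz := h0 η hη ⟨n + 2, fun x hx => Set.indicator_of_notMem (fun hx' => by
      have : ‖x‖ ≤ n + 1 := by simpa [B] using hx'
      linarith) _⟩ (by rw [integral_indicator (hBm n)]; exact hint)
    have hz2 : ∫ x in B n, v x * (v x - b) = 0 := by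
      rw [← integral_indicator (hBm n), ← hz]
      congr 1; ext x
      by_cases hx : x ∈ B n <;> simp [η, hx]
    have i1 : Integrable (fun x => v x * (v x - b)) (volume.restrict (B n)) :=
      hv2.integrable_mul hb2
    have hz3 : ∫ x in B n, (v x - b) ^ 2 = 0 := by
      have : ∀ x, (v x - b) ^ 2 = v x * (v x - b) - b * (v x - b) := fun x => by ring
      have i2 : Integrable (fun x => b * (v x - b)) (volume.restrict (B n)) :=
        (hvi.sub (integrable_const b)).const_mul b
      simp only [this]
      rw [integral_sub i1 i2, hz2,
        integral_const_mul, hint]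
      simp
    rw [integral_eq_zero_iff_of_nonneg (fun x => sq_nonneg _) hb2.integrable_sq] at hz3
    refine ⟨b, ?_⟩
    filter_upwards [hz3] with x hx
    have : (v x - b) ^ 2 = 0 := hx
    have := pow_eq_zero_iff (two_ne_zero) |>.1 this
    linarith
  choose b hb using key
  have hconst : ∀ n, b n = b 0 := by
    intro n
    have hsub : B 0 ⊆ B n := Metric.closedBall_subset_closedBall (by simp)
    have h1 : ∀ᵐ x ∂(volume.restrict (B 0)), v x = b n :=
      ae_restrict_of_ae_restrict_of_subset hsub (hb n)
    have : NeZero (volume.restrict (B 0)) := ⟨by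
      rw [Ne, Measure.restrict_eq_zero]; exact hBpos 0⟩
    obtain ⟨x, hx1, hx2⟩ := (h1.and (hb 0)).exists
    rw [← hx1, hx2]
  refine ⟨b 0, ?_⟩
  have hU : (⋃ n, B n) = Set.univ := by
    refine Set.eq_univ_of_forall fun x => ?_
    obtain ⟨n, hn⟩ := exists_nat_ge ‖x‖
    exact Set.mem_iUnion.2 ⟨n, by simp [B]; linarith⟩
  rw [← Measure.restrict_univ (μ := volume), ← hU, ae_restrict_iUnion_iff]
  intro n
  rw [← hconst n]
  exact hb n

lemma exists_sub_ae_eq_const_of_mem_phiPerp {ξ : E d → G → ℝ} (hξ : ξ ∈ PhiPerp d G) (a b : G) :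
    ∃ β : ℝ, ∀ᵐ x, ξ x a - ξ x b = β := by
  classical
  refine exists_ae_eq_const_of_forall_integral_mul_eq_zero
    (v := fun x => ξ x a - ξ x b) (fun S hS => (hξ.1 a S hS).sub (hξ.1 b S hS)) ?_
  rintro η hη ⟨R, hR⟩ hint
  -- Placing `η` on layer `a` and `-η` on layer `b` meets both constraints of `Φ`.
  have := hξ.2 (fun x g => η x * ((if g = a then 1 else 0) - (if g = b then 1 else 0)))
    ⟨fun g => by
      simpa [mul_comm] using
        hη.const_mul ((if g = a then 1 else 0) - (if g = b then 1 else 0) : ℝ),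
      ⟨R, fun g => Filter.Eventually.of_forall fun x hx => by simp [hR x hx]⟩,
      fun g => by rw [integral_mul_const, hint, zero_mul],
      Filter.Eventually.of_forall fun x => by
        rw [← Finset.mul_sum, Finset.sum_sub_distrib]; simp⟩
  rw [← this]
  congr 1; ext x
  simp only [mul_sub, Finset.sum_sub_distrib]
  simp
  ring

end Perp

/-! ### Merging a pair of potentials into a single one. -/

section Potentials

variable {d : ℕ} {G : Type*} [Fintype G] {K : G → G → ℝ} {τ : ℝ}
  {γ : G → Measure (E d × E d)} {h : E d → G → G → ℝ} {φ ψ : E d → G → ℝ}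

lemma zero_mem_phiPerp : (0 : E d → G → ℝ) ∈ PhiPerp d G :=
  ⟨fun _ _ _ => MemLp.zero, fun ε _ => by simp⟩

lemma ArePotentials.exists_single (hp : ArePotentials K τ γ h φ ψ) :
    ∃ φ : E d → G → ℝ, ArePotentials K τ γ h φ φ := by
  rcases isEmpty_or_nonempty G with hG | ⟨⟨g₀⟩⟩
  · exact ⟨φ, hp.cConcave, hp.supported, Filter.Eventually.of_forall fun _ g => hG.elim g,
      by rw [sub_self]; exact zero_mem_phiPerp⟩
  choose β hβ using fun g => exists_sub_ae_eq_const_of_mem_phiPerp hp.perp g g₀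
  -- Almost everywhere `φ_g - β_g` equals `ψ_g` plus the function `φ_{g₀} - ψ_{g₀}`, which does not
  -- depend on `g` and so drops out of differences between vertices.
  refine ⟨fun y g => φ y g - β g, fun g => (hp.cConcave g).sub_const _, fun g => ?_, ?_, ?_⟩
  · rw [cSuperdiff_sub_const]; exact hp.supported g
  · filter_upwards [hp.gradient, ae_all_iff.2 hβ] with y h1 h2 g g' hg
    have e1 := h2 g
    have e2 := h2 g'
    simp only [Pi.sub_apply] at e1 e2
    rw [← h1 g g' hg]
    linarith
  · rw [sub_self]; exact zero_mem_phiPerp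

end Potentials

/-! ### Potentials imply optimality. -/

section Sufficiency

variable {d : ℕ} {G : Type*} {τ : ℝ}

/-- The index set may be uncountable, so measurability comes from upper semicontinuity of an infimum
of continuous functions. -/
lemma measurable_iInf_coe {X ι : Type*} [TopologicalSpace X] [MeasurableSpace X]
    [OpensMeasurableSpace X] {f : ι → X → ℝ} (hf : ∀ i, Continuous (f i)) :
    Measurable fun x => ⨅ i, (f i x : EReal) := by
  refine UpperSemicontinuous.measurable (upperSemicontinuous_iInf fun i => ?_)
  exact (continuous_coe_real_ereal.comp (hf i)).upperSemicontinuous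

lemma IsCConcave.measurable {φ : E d → ℝ} (h : IsCConcave (quadCost τ) φ) : Measurable φ := by
  obtain ⟨η, hη⟩ := h
  have h1 : Measurable fun y => (φ y : EReal) := by
    simp only [hη]
    refine measurable_iInf_coe fun x => ?_
    unfold quadCost
    fun_prop
  exact h1.ereal_toReal

lemma measurable_cTransform (φ : E d → ℝ) : Measurable (cTransform (quadCost τ) φ) := by
  refine measurable_iInf_coe fun x => ?_
  unfold quadCost
  fun_prop

lemma IsCConcave.exists_upper_bound {φ : E d → ℝ} (h : IsCConcave (quadCost τ) φ) :
    ∃ a, ∀ y, φ y ≤ quadCost τ 0 y + a := by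
  obtain ⟨η, hη⟩ := h
  refine ⟨-η 0, fun y => ?_⟩
  have := (iInf_coe_eq_coe_iff.1 (hη y)).1 0
  linarith

lemma integrable_withDensity_ofReal_iff {f u : E d → ℝ} (hf : Integrable f volume)
    (hf0 : ∀ᵐ x, 0 ≤ f x) :
    Integrable u (volume.withDensity fun x => ENNReal.ofReal (f x)) ↔
      Integrable (fun x => u x * f x) volume := by
  rw [integrable_withDensity_iff_integrable_smul₀' hf.aestronglyMeasurable.aemeasurable.ennreal_ofReal
    (by simp)]
  refine integrable_congr ?_
  filter_upwards [hf0] with x hx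
  rw [ENNReal.toReal_ofReal hx, smul_eq_mul, mul_comm]

lemma integral_withDensity_ofReal {f u : E d → ℝ} (hf : Integrable f volume)
    (hf0 : ∀ᵐ x, 0 ≤ f x) :
    ∫ x, u x ∂(volume.withDensity fun x => ENNReal.ofReal (f x)) = ∫ x, u x * f x := by
  rw [integral_withDensity_eq_integral_toReal_smul₀
    hf.aestronglyMeasurable.aemeasurable.ennreal_ofReal (by simp)]
  refine integral_congr_ae ?_
  filter_upwards [hf0] with x hx
  rw [ENNReal.toReal_ofReal hx, smul_eq_mul, mul_comm]

/-- Functions that are bounded above by integrable functions and whose sum is integrable are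
integrable. -/
lemma integrable_of_le_of_integrable_sum {α ι : Type*} [MeasurableSpace α] {ν : Measure α}
    [Fintype ι] {F U : ι → α → ℝ} (hF : ∀ i, AEStronglyMeasurable (F i) ν)
    (hU : ∀ i, Integrable (U i) ν) (hFU : ∀ i, ∀ᵐ x ∂ν, F i x ≤ U i x)
    (hsum : Integrable (fun x => ∑ i, F i x) ν) (i : ι) : Integrable (F i) ν := by
  classical
  have hlow : ∀ᵐ x ∂ν, U i x - ∑ j, (U j x - F j x) ≤ F i x := by
    filter_upwards [ae_all_iff.2 hFU] with x hx
    have := Finset.single_le_sum (f := fun j => U j x - F j x)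
      (fun j _ => sub_nonneg.2 (hx j)) (Finset.mem_univ i)
    linarith
  have hint : Integrable (fun x => U i x - ∑ j, (U j x - F j x)) ν := by
    simp only [Finset.sum_sub_distrib]
    exact (hU i).sub ((integrable_finsetSum _ fun j _ => hU j).sub hsum)
  refine (hint.norm.add (hU i).norm).mono' (hF i) ?_
  filter_upwards [hlow, hFU i] with x h1 h2
  simp only [Pi.add_apply, Real.norm_eq_abs]
  rw [abs_le]
  constructor
  · have := neg_abs_le (U i x - ∑ j, (U j x - F j x))
    have := abs_nonneg (U i x)
    linarith
  · have := le_abs_self (U i x)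
    have := abs_nonneg (U i x - ∑ j, (U j x - F j x))
    linarith

variable [Fintype G] [MeasurableSpace G] {K : G → G → ℝ} {W : E d → ℝ}
  {μ σ : Measure (E d × G)} {γ γ' : G → Measure (E d × E d)} {h h' : E d → G → G → ℝ}
  {φ : E d → G → ℝ}

/-- The `c`-transform of a potential as a real function. -/
def realCTransform (τ : ℝ) (φ : E d → ℝ) (x : E d) : ℝ := (cTransform (quadCost τ) φ x).toReal

lemma measurable_realCTransform (φ : E d → ℝ) : Measurable (realCTransform τ φ) :=
  (measurable_cTransform φ).ereal_toReal

lemma realCTransform_eq {φ : E d → ℝ} {p : E d × E d} (hp : p ∈ cSuperdiff (quadCost τ) φ) :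
    realCTransform τ φ p.1 = quadCost τ p.1 p.2 - φ p.2 := by
  rw [realCTransform, cTransform_eq_of_forall (mem_cSuperdiff_iff.1 hp), EReal.toReal_coe]

lemma realCTransform_add_le {φ : E d → ℝ} {x : E d} (hx : cTransform (quadCost τ) φ x ≠ ⊥)
    (y : E d) : realCTransform τ φ x + φ y ≤ quadCost τ x y := by
  have h1 : cTransform (quadCost τ) φ x ≤ ((quadCost τ x y - φ y : ℝ) : EReal) := iInf_le _ y
  have h2 : cTransform (quadCost τ) φ x ≠ ⊤ := (h1.trans_lt (EReal.coe_lt_top _)).ne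
  rw [← EReal.coe_toReal h2 hx, EReal.coe_le_coe_iff] at h1
  unfold realCTransform
  linarith

lemma integrable_sq_quadCost_zero {α : Type*} [MeasurableSpace α] {ν : Measure α}
    [IsFiniteMeasure ν] {f : α → E d}
    (hf : Integrable (fun p => ‖f p‖ ^ 2) ν) (a : ℝ) :
    Integrable (fun p => quadCost τ 0 (f p) + a) ν := by
  unfold quadCost
  simp only [zero_sub, norm_neg]
  exact (hf.const_mul _).add (integrable_const _)

/-- On the superdifferential the transform lies below `c(x, 0) - f(0)` by minimality, and above
`-f(y)`, which is bounded below by a negative quadratic in `y`. Second moments then suffice, and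
`f(y)` is the cost minus the transform. -/
lemma IsAdmissible.integrable_potential (hK : IsConnectedWeightedGraph K) (hτ : 0 < τ)
    (hμ : IsP2 μ) (hσ : IsP2 σ) (hadm : IsAdmissible K W τ μ σ γ h)
    {f : E d → ℝ} (hf : IsCConcave (quadCost τ) f) {g : G}
    (hs : (γ g) (cSuperdiff (quadCost τ) f)ᶜ = 0) :
    Integrable (fun p : E d × E d => realCTransform τ f p.1) (γ g) ∧
      Integrable (fun p : E d × E d => f p.2) (γ g) := by
  have := hμ.prob
  have := hadm.isFiniteMeasure g
  have hs' : ∀ᵐ p ∂(γ g), p ∈ cSuperdiff (quadCost τ) f := mem_ae_iff.2 hs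
  obtain ⟨a, ha⟩ := hf.exists_upper_bound
  have i1 := integrable_sq_quadCost_zero (τ := τ) (hadm.integrable_fst_sq hμ g) (-f 0)
  have i2 := integrable_sq_quadCost_zero (τ := τ) (hadm.integrable_snd_sq hK hσ g) a
  have hc := hadm.integrable_cost hK hτ hμ hσ g
  have hu : Integrable (fun p : E d × E d => realCTransform τ f p.1) (γ g) := by
    refine (i1.norm.add i2.norm).mono'
      ((measurable_realCTransform f).comp measurable_fst).aestronglyMeasurable ?_
    filter_upwards [hs'] with p hp
    have e1 := realCTransform_eq hp
    have e2 := mem_cSuperdiff_iff.1 hp 0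
    have e3 := ha p.2
    have e4 := quadCost_nonneg hτ p.1 p.2
    have e5 : quadCost τ p.1 0 = quadCost τ 0 p.1 := by
      unfold quadCost; rw [norm_sub_rev]
    simp only [Pi.add_apply, Real.norm_eq_abs]
    rw [abs_le]
    constructor
    · have := le_abs_self (quadCost τ 0 p.2 + a)
      have := abs_nonneg (quadCost τ 0 p.1 + -f 0)
      linarith
    · have := abs_nonneg (quadCost τ 0 p.2 + a)
      have := le_abs_self (quadCost τ 0 p.1 + -f 0)
      linarith
  refine ⟨hu, (hc.sub hu).congr ?_⟩
  filter_upwards [hs'] with p hp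
  simp only [Pi.sub_apply]
  rw [realCTransform_eq hp]; ring

/-- Potentials certify optimality. -/
theorem ArePotentials.realCost_le (hp : ArePotentials K τ γ h φ φ)
    (hK : IsConnectedWeightedGraph K) (hW : Measurable W) (hτ : 0 < τ) (hμ : IsP2 μ)
    (hσ : IsP2 σ) (hac : ∀ g, fiber σ g ≪ volume) (hadm : IsAdmissible K W τ μ σ γ h)
    (hadm' : IsAdmissible K W τ μ σ γ' h') :
    realCost K W τ γ h ≤ realCost K W τ γ' h' := by
  have := hμ.prob
  have := hσ.prob
  have := fun g => hadm.isFiniteMeasure g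
  have := fun g => hadm'.isFiniteMeasure g
  set u : G → E d → ℝ := fun g => realCTransform τ (fun y => φ y g) with hu
  set f := transportedDensity K W τ σ h with hf
  set f' := transportedDensity K W τ σ h' with hf'
  have hφm : ∀ g, Measurable fun y => φ y g := fun g => (hp.cConcave g).measurable
  have hum : ∀ g, Measurable (u g) := fun g => measurable_realCTransform _
  have hs : ∀ g, ∀ᵐ p ∂(γ g), p ∈ cSuperdiff (quadCost τ) (fun y => φ y g) := fun g =>
    mem_ae_iff.2 (hp.supported g)
  have hfi : ∀ g, Integrable (f g) volume := fun g => integrable_transportedDensity hadm g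
  have hfi' : ∀ g, Integrable (f' g) volume := fun g => integrable_transportedDensity hadm' g
  have hf0 : ∀ g, ∀ᵐ x, 0 ≤ f g x := fun g => hadm.transportedDensity_nonneg (hac g)
  have hf0' : ∀ g, ∀ᵐ x, 0 ≤ f' g x := fun g => hadm'.transportedDensity_nonneg (hac g)
  -- pointwise exchange identity
  have hpt : ∀ᵐ y, ∑ g, φ y g * f' g y = (∑ g, φ y g * f g y) - ∑ g, ∑ g', τ / 2 *
      ((h' y g g' * h y g g' * K g g' * Real.exp (-W y))
        - h y g g' * h y g g' * K g g' * Real.exp (-W y)) := by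
    filter_upwards [hp.gradient] with y hy
    have e1 : ∀ g, φ y g * f' g y - φ y g * f g y =
        τ * (φ y g * outflow K W (fun x a b => h' x a b - h x a b) g y) := by
      intro g
      have : outflow K W (fun x a b => h' x a b - h x a b) g y =
          outflow K W h' g y - outflow K W h g y := by
        simp only [outflow, ← Finset.sum_sub_distrib, sub_mul]
      rw [this, hf, hf']; unfold transportedDensity; ring
    have e2 : (∑ g, φ y g * f' g y) - ∑ g, φ y g * f g y =
        τ * (-(1 / 2) * ∑ g, ∑ g', (φ y g' - φ y g) * (h' y g g' - h y g g') * K g g' *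
          Real.exp (-W y)) := by
      rw [← Finset.sum_sub_distrib, Finset.sum_congr rfl fun g _ => e1 g, ← Finset.mul_sum,
        sum_mul_outflow hK.symm]
      intro x g g'
      rw [hadm.antisymm x g g', hadm'.antisymm x g g']; ring
    rw [sub_eq_iff_eq_add'.1 e2, sub_eq_add_neg]
    congr 1
    simp only [Finset.mul_sum, ← Finset.sum_neg_distrib]
    refine Finset.sum_congr rfl fun g _ => Finset.sum_congr rfl fun g' _ => ?_
    -- The gradient condition is only available on true edges; the other pairs carry weight zero.
    rcases (hK.nonneg g g').eq_or_lt with h0 | h0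
    · rw [← h0]; ring
    · rw [hy g g' h0]; ring
  have ihh : ∀ g g', Integrable (fun y => h' y g g' * h y g g' * K g g' * Real.exp (-W y)) volume :=
    fun g g' => integrable_mul_of_memLp hW (hK.nonneg g g') (hadm'.memLp g g') (hadm.memLp g g')
  have ih : ∀ g g', Integrable (fun y => h y g g' * h y g g' * K g g' * Real.exp (-W y)) volume :=
    fun g g' => integrable_mul_of_memLp hW (hK.nonneg g g') (hadm.memLp g g') (hadm.memLp g g')
  have idiff : ∀ g g', Integrable (fun y => τ / 2 * (h' y g g' * h y g g' * K g g' *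
      Real.exp (-W y) - h y g g' * h y g g' * K g g' * Real.exp (-W y))) volume :=
    fun g g' => ((ihh g g').sub (ih g g')).const_mul _
  -- integrability of the potentials
  have hpot := fun g => hadm.integrable_potential hK hτ hμ hσ (hp.cConcave g) (hp.supported g)
  have iφ : ∀ g, Integrable (fun y => φ y g * f g y) volume := by
    intro g
    rw [← integrable_withDensity_ofReal_iff (hfi g) (hf0 g), ← hadm.map_snd_eq (hac g),
      integrable_map_measure (hφm g).aestronglyMeasurable measurable_snd.aemeasurable]
    exact (hpot g).2
  -- The competitor need not charge only the superdifferential, so each term is merely bounded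
  -- above. The pointwise identity makes the sum over `g` integrable, and this forces every term to
  -- be integrable.
  have iφ' : ∀ g, Integrable (fun y => φ y g * f' g y) volume := by
    choose a ha using fun g => (hp.cConcave g).exists_upper_bound
    refine integrable_of_le_of_integrable_sum (F := fun g y => φ y g * f' g y)
      (U := fun g y => (quadCost τ 0 y + a g) * f' g y)
      (fun g => (hφm g).aestronglyMeasurable.mul (hfi' g).aestronglyMeasurable) (fun g => ?_)
      (fun g => ?_) ?_
    · rw [← integrable_withDensity_ofReal_iff (hfi' g) (hf0' g), ← hadm'.map_snd_eq (hac g),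
        integrable_map_measure (by unfold quadCost; fun_prop) measurable_snd.aemeasurable]
      exact integrable_sq_quadCost_zero (hadm'.integrable_snd_sq hK hσ g) (a g)
    · filter_upwards [hf0' g] with y hy
      exact mul_le_mul_of_nonneg_right (ha g y) hy
    · refine Integrable.congr ?_ (hpt.mono fun _ => Eq.symm)
      exact (integrable_finsetSum _ fun g _ => iφ g).sub (integrable_finsetSum _ fun g _ =>
        integrable_finsetSum _ fun g' _ => idiff g g')
  -- transfer between plans
  have iu : ∀ g, Integrable (u g) (fiber μ g) := by
    intro g
    rw [← hadm.fst_marginal g,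
      integrable_map_measure (hum g).aestronglyMeasurable measurable_fst.aemeasurable]
    exact (hpot g).1
  -- The transform is finite wherever `γ_g` starts, hence `μ_g`-almost everywhere, a statement that
  -- passes to the competitor with the same first marginal.
  have hbot : ∀ g, ∀ᵐ x ∂(fiber μ g), cTransform (quadCost τ) (fun y => φ y g) x ≠ ⊥ := by
    intro g
    have hm : MeasurableSet {x | cTransform (quadCost τ) (fun y => φ y g) x ≠ ⊥} :=
      measurable_cTransform _ (measurableSet_singleton ⊥).compl
    rw [← hadm.fst_marginal g, ae_map_iff measurable_fst.aemeasurable hm]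
    filter_upwards [hs g] with p hp
    rw [cTransform_eq_of_forall (mem_cSuperdiff_iff.1 hp)]
    exact EReal.coe_ne_bot _
  have hC : ∀ g, ∫ p, quadCost τ p.1 p.2 ∂(γ g) = ∫ x, u g x ∂(fiber μ g) + ∫ y, φ y g * f g y := by
    intro g
    rw [← hadm.fst_marginal g, ← integral_withDensity_ofReal (hfi g) (hf0 g),
      ← hadm.map_snd_eq (hac g), integral_map measurable_fst.aemeasurable
      (hum g).aestronglyMeasurable, integral_map measurable_snd.aemeasurable
      (hφm g).aestronglyMeasurable, ← integral_add (hpot g).1 (hpot g).2]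
    refine integral_congr_ae ?_
    filter_upwards [hs g] with p hp
    rw [realCTransform_eq hp]; ring
  have hC' : ∀ g, ∫ x, u g x ∂(fiber μ g) + ∫ y, φ y g * f' g y
      ≤ ∫ p, quadCost τ p.1 p.2 ∂(γ' g) := by
    intro g
    have j1 : Integrable (fun p : E d × E d => u g p.1) (γ' g) := by
      have := iu g
      rwa [← hadm'.fst_marginal g,
        integrable_map_measure (hum g).aestronglyMeasurable measurable_fst.aemeasurable] at this
    have j2 : Integrable (fun p : E d × E d => φ p.2 g) (γ' g) := by
      have := iφ' g
      rwa [← integrable_withDensity_ofReal_iff (hfi' g) (hf0' g), ← hadm'.map_snd_eq (hac g),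
        integrable_map_measure (hφm g).aestronglyMeasurable measurable_snd.aemeasurable] at this
    have hb := hbot g
    rw [← hadm'.fst_marginal g] at hb ⊢
    rw [← integral_withDensity_ofReal (hfi' g) (hf0' g),
      ← hadm'.map_snd_eq (hac g), integral_map measurable_fst.aemeasurable
      (hum g).aestronglyMeasurable, integral_map measurable_snd.aemeasurable
      (hφm g).aestronglyMeasurable, ← integral_add j1 j2]
    refine integral_mono_ae (j1.add j2) (hadm'.integrable_cost hK hτ hμ hσ g) ?_
    filter_upwards [ae_of_ae_map measurable_fst.aemeasurable hb] with p hp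
    exact realCTransform_add_le hp p.2
  have hsum : ∑ g, ∫ y, φ y g * f' g y = (∑ g, ∫ y, φ y g * f g y) -
      ∑ g, ∑ g', τ / 2 * ((∫ y, h' y g g' * h y g g' * K g g' * Real.exp (-W y)) -
        ∫ y, h y g g' * h y g g' * K g g' * Real.exp (-W y)) := by
    rw [← integral_finsetSum _ fun g _ => iφ' g, integral_congr_ae hpt, integral_sub
      (integrable_finsetSum _ fun g _ => iφ g) (integrable_finsetSum _ fun g _ =>
        integrable_finsetSum _ fun g' _ => idiff g g'),
      integral_finsetSum _ fun g _ => iφ g, integral_finsetSum _ fun g _ =>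
        integrable_finsetSum _ fun g' _ => idiff g g']
    congr 1
    refine Finset.sum_congr rfl fun g _ => ?_
    rw [integral_finsetSum _ fun g' _ => idiff g g']
    refine Finset.sum_congr rfl fun g' _ => ?_
    rw [integral_const_mul, integral_sub (ihh g g') (ih g g')]
  have hE : ∀ g g', (∫ x, τ / 4 * (h x g g' ^ 2 * K g g' * Real.exp (-W x))) +
      τ / 2 * ((∫ y, h' y g g' * h y g g' * K g g' * Real.exp (-W y)) -
        ∫ y, h y g g' * h y g g' * K g g' * Real.exp (-W y)) ≤
      ∫ x, τ / 4 * (h' x g g' ^ 2 * K g g' * Real.exp (-W x)) := by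
    intro g g'
    rw [← integral_sub (ihh g g') (ih g g'), ← integral_const_mul, ← integral_add
      ((hadm.integrable_energy hK hW g g').const_mul _) (idiff g g')]
    refine integral_mono (((hadm.integrable_energy hK hW g g').const_mul _).add
      (idiff g g'))
      ((hadm'.integrable_energy hK hW g g').const_mul _) fun x => ?_
    -- Completing the square: the tangent line of the quadratic energy at `h` lies below the energy
    -- of `h'`.
    have h1 : 0 ≤ τ / 4 * ((h' x g g' - h x g g') ^ 2 * (K g g' * Real.exp (-W x))) := by
      have := hK.nonneg g g'
      positivity
    beta_reduce
    nlinarith [h1]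
  have hE' := Finset.sum_le_sum fun g (_ : g ∈ Finset.univ) =>
    Finset.sum_le_sum fun g' (_ : g' ∈ Finset.univ) => hE g g'
  have hC'' := Finset.sum_le_sum fun g (_ : g ∈ Finset.univ) => hC' g
  simp only [Finset.sum_add_distrib] at hE' hC''
  unfold realCost
  rw [Finset.sum_congr rfl fun g _ => hC g, Finset.sum_add_distrib]
  linarith

end Sufficiency

/-! ### Cyclic rearrangements and the exchange that compensates them. -/

open scoped NNReal ENNReal in
/-- Finitely many small pieces `plan i` of the transport plans `γ (layer i)`, whose second marginals
are to be permuted cyclically by `next`, together with an exchange of mass from `layer i` to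
`layer (next i)`. -/
structure Rearrangement {d : ℕ} {G : Type*} (K : G → G → ℝ) (W : E d → ℝ)
    (γ : G → Measure (E d × E d)) (ι : Type*) [Fintype ι] where
  next : Equiv.Perm ι
  layer : ι → G
  plan : ι → Measure (E d × E d)
  dens : ι → E d → ℝ
  C : ℝ≥0
  M : ℝ
  prob : ∀ i, IsProbabilityMeasure (plan i)
  plan_le : ∀ i, plan i ≤ (C : ℝ≥0∞) • γ (layer i)
  map_snd : ∀ i, (plan i).map Prod.snd = volume.withDensity fun x => ENNReal.ofReal (dens i x)
  measurable_dens : ∀ i, Measurable (dens i)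
  dens_nonneg : ∀ i x, 0 ≤ dens i x
  dens_le : ∀ i x, dens i x ≤ M
  potential_le : ∀ i x, dens i x ≠ 0 → W x ≤ M
  edge : ∀ i, layer i = layer (next i) ∨ 0 < K (layer i) (layer (next i))

namespace Rearrangement

section

variable {d : ℕ} {G : Type*} {K : G → G → ℝ} {W : E d → ℝ}
  {γ : G → Measure (E d × E d)} {ι : Type*} [Fintype ι] (R : Rearrangement K W γ ι)

/-- First marginals of the pieces. -/
def fst (i : ι) : Measure (E d) := (R.plan i).map Prod.fst

/-- Second marginals of the pieces. -/
def snd (i : ι) : Measure (E d) := (R.plan i).map Prod.snd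

lemma isProbabilityMeasure_fst (i : ι) : IsProbabilityMeasure (R.fst i) :=
  have := R.prob i
  Measure.isProbabilityMeasure_map measurable_fst.aemeasurable

lemma isProbabilityMeasure_snd (i : ι) : IsProbabilityMeasure (R.snd i) :=
  have := R.prob i
  Measure.isProbabilityMeasure_map measurable_snd.aemeasurable

lemma integrable_dens (i : ι) : Integrable (R.dens i) volume := by
  refine ⟨(R.measurable_dens i).aestronglyMeasurable, ?_⟩
  rw [hasFiniteIntegral_iff_ofReal (Filter.Eventually.of_forall (R.dens_nonneg i))]
  have := R.isProbabilityMeasure_snd i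
  have h1 : R.snd i Set.univ = ∫⁻ x, ENNReal.ofReal (R.dens i x) := by
    rw [snd, R.map_snd, withDensity_apply _ MeasurableSet.univ, Measure.restrict_univ]
  rw [← h1]
  exact measure_lt_top _ _

lemma integral_dens (i : ι) : ∫ x, R.dens i x = 1 := by
  have := R.isProbabilityMeasure_snd i
  have h1 : R.snd i Set.univ = ∫⁻ x, ENNReal.ofReal (R.dens i x) := by
    rw [snd, R.map_snd, withDensity_apply _ MeasurableSet.univ, Measure.restrict_univ]
  rw [integral_eq_lintegral_of_nonneg_ae (Filter.Eventually.of_forall (R.dens_nonneg i))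
    (R.measurable_dens i).aestronglyMeasurable, ← h1, measure_univ, ENNReal.toReal_one]

lemma real_snd (i : ι) {A : Set (E d)} (hA : MeasurableSet A) :
    (R.snd i).real A = ∫ x in A, R.dens i x := by
  rw [integral_eq_lintegral_of_nonneg_ae (Filter.Eventually.of_forall (R.dens_nonneg i))
    (R.measurable_dens i).aestronglyMeasurable, measureReal_def, snd, R.map_snd,
    withDensity_apply _ hA]

open scoped Classical in
/-- The sign with which the `i`-th piece contributes to the exchange from `g` to `g'`. -/
def sign (i : ι) (g g' : G) : ℝ :=
  (if R.layer i = g ∧ R.layer (R.next i) = g' then 1 else 0) -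
    (if R.layer i = g' ∧ R.layer (R.next i) = g then 1 else 0)

lemma sign_antisymm (i : ι) (g g' : G) : R.sign i g g' = -R.sign i g' g := by
  unfold sign; ring

lemma sign_eq_zero (i : ι) {g g' : G} (hK : ∀ g g', K g g' = K g' g) (h0 : K g g' = 0) :
    R.sign i g g' = 0 := by
  classical
  unfold sign
  rcases R.edge i with h | h
  -- A piece staying in its layer contributes equally to both indicators.
  · rw [← h]
    rw [sub_eq_zero]
    exact if_congr and_comm rfl rfl
  · rw [if_neg, if_neg, sub_self]
    · rintro ⟨rfl, rfl⟩; rw [hK] at h0; exact h.ne' h0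
    · rintro ⟨rfl, rfl⟩; exact h.ne' h0

/-- The exchange of mass created by the rearrangement. -/
def exchange (τ : ℝ) (x : E d) (g g' : G) : ℝ :=
  ∑ i, R.sign i g g' * (R.dens (R.next i) x * Real.exp (W x) / (τ * K g g'))

lemma exchange_antisymm (hK : ∀ g g', K g g' = K g' g) (τ : ℝ) (x : E d) (g g' : G) :
    R.exchange τ x g g' = -R.exchange τ x g' g := by
  simp only [exchange, ← Finset.sum_neg_distrib]
  refine Finset.sum_congr rfl fun i _ => ?_
  rw [R.sign_antisymm i g g', hK g g']; ring

lemma measurable_exchange (hW : Measurable W) (τ : ℝ) (g g' : G) :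
    Measurable fun x => R.exchange τ x g g' := by
  have := R.measurable_dens
  unfold exchange
  fun_prop

/-- The factor `exp(W) / (τ K)` is chosen so that the mass flux is a plain density. Where `K`
vanishes the division gives zero, and the sign vanishes as well. -/
lemma exchange_mul (hK : ∀ g g', K g g' = K g' g) {τ : ℝ} (hτ : 0 < τ) (x : E d) (g g' : G) :
    R.exchange τ x g g' * K g g' * Real.exp (-W x) =
      ∑ i, R.sign i g g' * (R.dens (R.next i) x / τ) := by
  simp only [exchange, Finset.sum_mul]
  refine Finset.sum_congr rfl fun i _ => ?_
  by_cases h0 : K g g' = 0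
  · rw [R.sign_eq_zero i hK h0]; ring
  · rw [Real.exp_neg]
    have := Real.exp_ne_zero (W x)
    have := hτ.ne'
    field_simp

/-- `W` is bounded above wherever the density is nonzero. Hence the exchange is bounded, which gives
its weighted square integrability although `W` is only measurable. -/
lemma abs_dens_mul_exp_le (i : ι) (x : E d) :
    |R.dens i x * Real.exp (W x)| ≤ R.M * Real.exp R.M := by
  have h0 := R.dens_nonneg i x
  rw [abs_of_nonneg (by positivity)]
  by_cases h : R.dens i x = 0
  · rw [h, zero_mul]
    have := h0.trans (R.dens_le i x)
    positivity
  · have h1 := R.dens_le i x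
    have h2 := R.potential_le i x h
    have := h0.trans h1
    gcongr

lemma exists_abs_exchange_le (τ : ℝ) (g g' : G) : ∃ B, ∀ x, |R.exchange τ x g g'| ≤ B := by
  refine ⟨∑ i, |R.sign i g g'| * (R.M * Real.exp R.M / |τ * K g g'|), fun x => ?_⟩
  refine (Finset.abs_sum_le_sum_abs _ _).trans (Finset.sum_le_sum fun i _ => ?_)
  rw [abs_mul, abs_div]
  have := R.abs_dens_mul_exp_le (R.next i) x
  gcongr

lemma integrable_exchange_mul (hK : ∀ g g', K g g' = K g' g) {τ : ℝ} (hτ : 0 < τ) (g g' : G) :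
    Integrable (fun x => R.exchange τ x g g' * K g g' * Real.exp (-W x)) volume := by
  simp only [R.exchange_mul hK hτ]
  exact integrable_finsetSum _ fun i _ => ((R.integrable_dens _).div_const _).const_mul _

lemma memLp_exchange (hK : IsConnectedWeightedGraph K) (hW : Measurable W) {τ : ℝ} (hτ : 0 < τ)
    (g g' : G) : MemLp (fun x => R.exchange τ x g g') 2
      (volume.withDensity fun x => ENNReal.ofReal (K g g' * Real.exp (-W x))) := by
  rw [memLp_two_iff_integrable_sq (R.measurable_exchange hW τ g g').aestronglyMeasurable,
    integrable_withDensity_iff_integrable_smul' (by fun_prop) (by simp)]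
  obtain ⟨B, hB⟩ := R.exists_abs_exchange_le τ g g'
  refine Integrable.congr ((R.integrable_exchange_mul hK.symm hτ g g').bdd_mul (c := B)
    (R.measurable_exchange hW τ g g').aestronglyMeasurable (Filter.Eventually.of_forall hB)) ?_
  refine Filter.Eventually.of_forall fun x => ?_
  simp only [smul_eq_mul]
  rw [ENNReal.toReal_ofReal (mul_nonneg (hK.nonneg _ _) (Real.exp_nonneg _))]
  ring

open scoped Classical in
lemma outflow_exchange [Fintype G] (hK : ∀ g g', K g g' = K g' g) {τ : ℝ} (hτ : 0 < τ) (g : G)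
    (x : E d) :
    outflow K W (R.exchange τ) g x = ∑ i, ((if R.layer i = g then 1 else 0) -
      (if R.layer (R.next i) = g then 1 else 0)) * (R.dens (R.next i) x / τ) := by
  simp only [outflow, R.exchange_mul hK hτ]
  rw [Finset.sum_comm]
  refine Finset.sum_congr rfl fun i _ => ?_
  rw [← Finset.sum_mul]
  congr 1
  simp only [sign, Finset.sum_sub_distrib, ite_and]
  simp

/-- The factor `2` arises because each jump is counted once in each direction and both counts agree
by antisymmetry of `h`. -/
lemma sum_mul_exchange [Fintype G] (hK : ∀ g g', K g g' = K g' g) {τ : ℝ} (hτ : 0 < τ)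
    {h : E d → G → G → ℝ} (hh : ∀ x g g', h x g g' = -h x g' g) (x : E d) :
    ∑ g, ∑ g', h x g g' * R.exchange τ x g g' * K g g' * Real.exp (-W x) =
      2 / τ * ∑ i, h x (R.layer i) (R.layer (R.next i)) * R.dens (R.next i) x := by
  classical
  have e : ∀ g g', h x g g' * R.exchange τ x g g' * K g g' * Real.exp (-W x) =
      ∑ i, h x g g' * (R.sign i g g' * (R.dens (R.next i) x / τ)) := fun g g' => by
    rw [← Finset.mul_sum, ← R.exchange_mul hK hτ]; ring
  simp only [e]
  have e2 : ∀ i, ∑ g, ∑ g', h x g g' * (R.sign i g g' * (R.dens (R.next i) x / τ)) =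
      2 / τ * (h x (R.layer i) (R.layer (R.next i)) * R.dens (R.next i) x) := by
    intro i
    have e3 : ∑ g, ∑ g', h x g g' * R.sign i g g' =
        2 * h x (R.layer i) (R.layer (R.next i)) := by
      have a1 : ∀ a b : G, ∑ g, ∑ g', h x g g' * (if a = g ∧ b = g' then 1 else 0) = h x a b := by
        intro a b
        simp [ite_and]
      have a2 : ∀ a b : G, ∑ g, ∑ g', h x g g' * (if a = g' ∧ b = g then 1 else 0) = h x b a := by
        intro a b
        simp [ite_and]
      simp only [sign, mul_sub, Finset.sum_sub_distrib, a1, a2]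
      rw [hh x (R.layer (R.next i))]; ring
    have e4 : ∀ g g', h x g g' * (R.sign i g g' * (R.dens (R.next i) x / τ)) =
        h x g g' * R.sign i g g' * (R.dens (R.next i) x / τ) := fun _ _ => by ring
    simp only [e4, ← Finset.sum_mul, e3]
    ring
  calc _ = ∑ i, ∑ g, ∑ g', h x g g' * (R.sign i g g' * (R.dens (R.next i) x / τ)) := by
        rw [Finset.sum_comm (s := (Finset.univ : Finset ι))]
        exact Finset.sum_congr rfl fun g _ => Finset.sum_comm
    _ = _ := by rw [Finset.mul_sum]; exact Finset.sum_congr rfl fun i _ => e2 i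

end

end Rearrangement

/-! ### The perturbed pair, its admissibility and the first variation. -/

namespace Rearrangement

open scoped NNReal ENNReal

variable {d : ℕ} {G : Type*} {K : G → G → ℝ} {W : E d → ℝ}
  {γ : G → Measure (E d × E d)} {ι : Type*} [Fintype ι] (R : Rearrangement K W γ ι)

open scoped Classical in
/-- The mass of the `i`-th piece that is moved inside the layer `g`. -/
def weight (δ : ℝ) (i : ι) (g : G) : ℝ≥0∞ := if R.layer i = g then ENNReal.ofReal δ else 0

lemma weight_ne_top (δ : ℝ) (i : ι) (g : G) : R.weight δ i g ≠ ⊤ := by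
  unfold weight; split_ifs <;> simp

open scoped Classical in
lemma toReal_weight {δ : ℝ} (hδ : 0 ≤ δ) (i : ι) (g : G) :
    (R.weight δ i g).toReal = δ * (if R.layer i = g then 1 else 0) := by
  unfold weight; split_ifs <;> simp [hδ]

/-- The part of the plans that is rearranged. -/
def removed (δ : ℝ) (g : G) : Measure (E d × E d) := ∑ i, R.weight δ i g • R.plan i

/-- The part of the plans that replaces `removed`. -/
def added (δ : ℝ) (g : G) : Measure (E d × E d) :=
  ∑ i, R.weight δ i g • (R.fst i).prod (R.snd (R.next i))

/-- The plans after rearrangement. -/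
def newPlan (δ : ℝ) (g : G) : Measure (E d × E d) := (γ g - R.removed δ g) + R.added δ g

/-- Each piece is dominated by `C` times its plan, so `card ι` pieces of mass `δ` fit inside. This
keeps the new plan a positive measure. -/
lemma removed_le {δ : ℝ} (hδ : ENNReal.ofReal δ * (Fintype.card ι * R.C) ≤ 1) (g : G) :
    R.removed δ g ≤ γ g := by
  intro A
  have h1 : ∀ i, R.weight δ i g * R.plan i A ≤ ENNReal.ofReal δ * (R.C * γ g A) := by
    intro i
    unfold weight
    split_ifs with hi
    · gcongr
      have := R.plan_le i A
      rwa [hi] at this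
    · simp
  calc R.removed δ g A = ∑ i, R.weight δ i g * R.plan i A := by
        simp [removed, Measure.finsetSum_apply]
    _ ≤ ∑ _i : ι, ENNReal.ofReal δ * (R.C * γ g A) := Finset.sum_le_sum fun i _ => h1 i
    _ = ENNReal.ofReal δ * (Fintype.card ι * R.C) * γ g A := by
        rw [Finset.sum_const, nsmul_eq_mul, Finset.card_univ]; ring
    _ ≤ 1 * γ g A := by gcongr
    _ = γ g A := one_mul _

lemma sub_add_removed {δ : ℝ} (hδ : ENNReal.ofReal δ * (Fintype.card ι * R.C) ≤ 1) (g : G)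
    [IsFiniteMeasure (γ g)] : (γ g - R.removed δ g) + R.removed δ g = γ g := by
  have : IsFiniteMeasure (R.removed δ g) := isFiniteMeasure_of_le _ (R.removed_le hδ g)
  exact Measure.sub_add_cancel_of_le (R.removed_le hδ g)

lemma map_fst_added (δ : ℝ) (g : G) :
    (R.added δ g).map Prod.fst = (R.removed δ g).map Prod.fst := by
  have := R.isProbabilityMeasure_snd
  rw [added, removed, Measure.map_finset_sum' measurable_fst.aemeasurable,
    Measure.map_finset_sum' measurable_fst.aemeasurable]
  refine Finset.sum_congr rfl fun i _ => ?_
  rw [Measure.map_smul, Measure.map_smul, Measure.map_fst_prod, measure_univ, one_smul]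
  rfl

lemma map_snd_added (δ : ℝ) (g : G) :
    (R.added δ g).map Prod.snd = ∑ i, R.weight δ i g • R.snd (R.next i) := by
  have := R.isProbabilityMeasure_fst
  have := R.isProbabilityMeasure_snd
  rw [added, Measure.map_finset_sum' measurable_snd.aemeasurable]
  refine Finset.sum_congr rfl fun i _ => ?_
  rw [Measure.map_smul, Measure.map_snd_prod, measure_univ, one_smul]

lemma map_snd_removed (δ : ℝ) (g : G) :
    (R.removed δ g).map Prod.snd = ∑ i, R.weight δ i g • R.snd i := by
  rw [removed, Measure.map_finset_sum' measurable_snd.aemeasurable]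
  exact Finset.sum_congr rfl fun i _ => Measure.map_smul _ _ _

lemma map_fst_newPlan {δ : ℝ} (hδ : ENNReal.ofReal δ * (Fintype.card ι * R.C) ≤ 1) (g : G)
    [IsFiniteMeasure (γ g)] : (R.newPlan δ g).map Prod.fst = (γ g).map Prod.fst := by
  conv_rhs => rw [← R.sub_add_removed hδ g]
  rw [newPlan, Measure.map_add _ _ measurable_fst, Measure.map_add _ _ measurable_fst,
    map_fst_added]

open scoped Classical in
lemma real_sum_weight {δ : ℝ} (hδ : 0 ≤ δ) (g : G) (ρ : ι → Measure (E d))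
    [∀ i, IsFiniteMeasure (ρ i)] (A : Set (E d)) :
    (∑ i, R.weight δ i g • ρ i).real A =
      ∑ i, δ * (if R.layer i = g then 1 else 0) * (ρ i).real A := by
  rw [measureReal_def, Measure.finsetSum_apply, ENNReal.toReal_sum]
  · refine Finset.sum_congr rfl fun i _ => ?_
    rw [Measure.smul_apply, smul_eq_mul, ENNReal.toReal_mul, R.toReal_weight hδ]
    rfl
  · intro i _
    rw [Measure.smul_apply, smul_eq_mul]
    exact ENNReal.mul_ne_top (R.weight_ne_top _ _ _) (measure_ne_top _ _)

lemma isFiniteMeasure_sum_weight (δ : ℝ) (g : G) {α : Type*} [MeasurableSpace α]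
    (ρ : ι → Measure α) [∀ i, IsFiniteMeasure (ρ i)] :
    IsFiniteMeasure (∑ i, R.weight δ i g • ρ i) := by
  have : ∀ i, IsFiniteMeasure (R.weight δ i g • ρ i) := fun i =>
    Measure.smul_finite _ (R.weight_ne_top _ _ _)
  infer_instance

open scoped Classical in
lemma real_map_snd_newPlan {δ : ℝ} (hδ0 : 0 ≤ δ)
    (hδ : ENNReal.ofReal δ * (Fintype.card ι * R.C) ≤ 1) (g : G)
    [IsFiniteMeasure (γ g)] (A : Set (E d)) :
    ((R.newPlan δ g).map Prod.snd).real A = ((γ g).map Prod.snd).real A +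
      δ * ∑ i, ((if R.layer i = g then 1 else 0) -
        (if R.layer (R.next i) = g then 1 else 0)) * (R.snd (R.next i)).real A := by
  have := R.isProbabilityMeasure_snd
  have := R.isFiniteMeasure_sum_weight δ g R.snd
  have := R.isFiniteMeasure_sum_weight δ g (fun i => R.snd (R.next i))
  have : IsFiniteMeasure (γ g - R.removed δ g) := isFiniteMeasure_of_le (γ g) Measure.sub_le
  conv_rhs => rw [← R.sub_add_removed hδ g]
  rw [newPlan, Measure.map_add _ _ measurable_snd, Measure.map_add _ _ measurable_snd,
    map_snd_added, map_snd_removed, measureReal_add_apply, measureReal_add_apply,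
    R.real_sum_weight hδ0, R.real_sum_weight hδ0, add_assoc]
  congr 1
  -- Reindexing the removed marginals by `next` pairs what leaves the layer of `next i` with what
  -- the layer of `i` receives.
  rw [← Equiv.sum_comp R.next
    (fun i => δ * (if R.layer i = g then 1 else 0) * (R.snd i).real A), Finset.mul_sum,
    ← Finset.sum_add_distrib]
  exact Finset.sum_congr rfl fun i _ => by ring

open scoped Classical in
lemma integral_sum_weight {δ : ℝ} (hδ : 0 ≤ δ) (g : G) {α : Type*} [MeasurableSpace α]
    {ρ : ι → Measure α} {f : α → ℝ} (hf : ∀ i, Integrable f (ρ i)) :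
    ∫ x, f x ∂(∑ i, R.weight δ i g • ρ i) =
      ∑ i, δ * (if R.layer i = g then 1 else 0) * ∫ x, f x ∂(ρ i) := by
  rw [integral_finsetSum_measure fun i _ => (hf i).smul_measure (R.weight_ne_top _ _ _)]
  refine Finset.sum_congr rfl fun i _ => ?_
  rw [integral_smul_measure, R.toReal_weight hδ, smul_eq_mul]

lemma integrable_sum_weight (δ : ℝ) (g : G) {α : Type*} [MeasurableSpace α]
    {ρ : ι → Measure α} {f : α → ℝ} (hf : ∀ i, Integrable f (ρ i)) :
    Integrable f (∑ i, R.weight δ i g • ρ i) :=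
  integrable_finsetSum_measure.2 fun i _ => (hf i).smul_measure (R.weight_ne_top _ _ _)

variable [Fintype G] {τ : ℝ} {h : E d → G → G → ℝ}

/-- The exchange map after rearrangement. -/
def newExchange (τ : ℝ) (h : E d → G → G → ℝ) (δ : ℝ) (x : E d) (g g' : G) : ℝ :=
  h x g g' + δ * R.exchange τ x g g'

lemma outflow_newExchange (δ : ℝ) (g : G) (x : E d) :
    outflow K W (R.newExchange τ h δ) g x =
      outflow K W h g x + δ * outflow K W (R.exchange τ) g x := by
  simp only [outflow, newExchange, Finset.mul_sum, ← Finset.sum_add_distrib]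
  exact Finset.sum_congr rfl fun _ _ => by ring

lemma integrable_outflow_exchange (hK : IsConnectedWeightedGraph K) (hτ : 0 < τ) (g : G) :
    Integrable (outflow K W (R.exchange τ) g) volume :=
  integrable_finsetSum _ fun g' _ => R.integrable_exchange_mul hK.symm hτ g g'

variable [MeasurableSpace G] {μ σ : Measure (E d × G)}

lemma isAdmissible_new (hK : IsConnectedWeightedGraph K) (hW : Measurable W) (hτ : 0 < τ)
    [IsFiniteMeasure μ] (hadm : IsAdmissible K W τ μ σ γ h) {δ : ℝ} (hδ0 : 0 ≤ δ)
    (hδ : ENNReal.ofReal δ * (Fintype.card ι * R.C) ≤ 1) :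
    IsAdmissible K W τ μ σ (R.newPlan δ) (R.newExchange τ h δ) where
  fst_marginal g := by
    have := hadm.isFiniteMeasure g
    rw [R.map_fst_newPlan hδ, hadm.fst_marginal]
  antisymm x g g' := by
    unfold newExchange
    rw [hadm.antisymm, R.exchange_antisymm hK.symm]; ring
  memLp g g' := (hadm.memLp g g').add ((R.memLp_exchange hK hW hτ g g').const_mul δ)
  integrable_outflow g := by
    have : outflow K W (R.newExchange τ h δ) g = fun x =>
        outflow K W h g x + δ * outflow K W (R.exchange τ) g x :=
      funext fun x => R.outflow_newExchange δ g x
    rw [this]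
    exact (hadm.integrable_outflow g).add ((R.integrable_outflow_exchange hK hτ g).const_mul δ)
  snd_marginal g A hA := by
    classical
    have := hadm.isFiniteMeasure g
    simp only [R.outflow_newExchange]
    rw [R.real_map_snd_newPlan hδ0 hδ, hadm.snd_marginal g A hA,
      integral_add (hadm.integrable_outflow g).integrableOn
        ((R.integrable_outflow_exchange hK hτ g).const_mul δ).integrableOn, integral_const_mul]
    simp only [R.outflow_exchange hK.symm hτ, R.real_snd _ hA]
    rw [integral_finsetSum _ fun i _ =>
      (((R.integrable_dens _).div_const _).const_mul _).integrableOn]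
    simp only [integral_const_mul, integral_div]
    have : ∀ i, ((if R.layer i = g then 1 else 0) - (if R.layer (R.next i) = g then 1 else 0)) *
        ((∫ x in A, R.dens (R.next i) x) / τ) = ((if R.layer i = g then 1 else 0) -
        (if R.layer (R.next i) = g then 1 else 0)) * (∫ x in A, R.dens (R.next i) x) * τ⁻¹ :=
      fun i => by ring
    simp only [this, ← Finset.sum_mul]
    have := hτ.ne'
    field_simp
    ring

lemma integrable_cost_plan (hK : IsConnectedWeightedGraph K) (hτ : 0 < τ) (hμ : IsP2 μ)
    (hσ : IsP2 σ) (hadm : IsAdmissible K W τ μ σ γ h) (i : ι) :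
    Integrable (fun p : E d × E d => quadCost τ p.1 p.2) (R.plan i) :=
  ((hadm.integrable_cost hK hτ hμ hσ _).smul_measure ENNReal.coe_ne_top).mono_measure
    (R.plan_le i)

lemma integrable_cost_prod (hK : IsConnectedWeightedGraph K) (hτ : 0 < τ) (hμ : IsP2 μ)
    (hσ : IsP2 σ) (hadm : IsAdmissible K W τ μ σ γ h) (i j : ι) :
    Integrable (fun p : E d × E d => quadCost τ p.1 p.2) ((R.fst i).prod (R.snd j)) := by
  have := hμ.prob
  have := R.isProbabilityMeasure_fst
  have := R.isProbabilityMeasure_snd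
  have h1 : Integrable (fun x => ‖x‖ ^ 2) (R.fst i) := by
    rw [fst, integrable_map_measure (by fun_prop) measurable_fst.aemeasurable]
    exact ((hadm.integrable_fst_sq hμ _).smul_measure ENNReal.coe_ne_top).mono_measure
      (R.plan_le i)
  have h2 : Integrable (fun x => ‖x‖ ^ 2) (R.snd j) := by
    rw [snd, integrable_map_measure (by fun_prop) measurable_snd.aemeasurable]
    exact ((hadm.integrable_snd_sq hK hσ _).smul_measure ENNReal.coe_ne_top).mono_measure
      (R.plan_le j)
  refine (((h1.comp_fst (R.snd j)).add (h2.comp_snd (R.fst i))).const_mul (1 / τ)).mono'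
    (by fun_prop) (Filter.Eventually.of_forall fun p => ?_)
  rw [Real.norm_of_nonneg (quadCost_nonneg hτ _ _)]
  exact quadCost_le hτ _ _

lemma sum_integral_newPlan (hK : IsConnectedWeightedGraph K) (hτ : 0 < τ) (hμ : IsP2 μ)
    (hσ : IsP2 σ) (hadm : IsAdmissible K W τ μ σ γ h) {δ : ℝ} (hδ0 : 0 ≤ δ)
    (hδ : ENNReal.ofReal δ * (Fintype.card ι * R.C) ≤ 1) :
    ∑ g, ∫ p, quadCost τ p.1 p.2 ∂(R.newPlan δ g) = (∑ g, ∫ p, quadCost τ p.1 p.2 ∂(γ g)) +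
      δ * ∑ i, ((∫ p, quadCost τ p.1 p.2 ∂((R.fst i).prod (R.snd (R.next i)))) -
        ∫ p, quadCost τ p.1 p.2 ∂(R.plan i)) := by
  classical
  have := hμ.prob
  have e : ∀ g, ∫ p, quadCost τ p.1 p.2 ∂(R.newPlan δ g) = (∫ p, quadCost τ p.1 p.2 ∂(γ g)) +
      ∑ i, δ * (if R.layer i = g then 1 else 0) *
        ((∫ p, quadCost τ p.1 p.2 ∂((R.fst i).prod (R.snd (R.next i)))) -
        ∫ p, quadCost τ p.1 p.2 ∂(R.plan i)) := by
    intro g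
    have := hadm.isFiniteMeasure g
    have i0 : Integrable (fun p : E d × E d => quadCost τ p.1 p.2) (γ g - R.removed δ g) :=
      (hadm.integrable_cost hK hτ hμ hσ g).mono_measure Measure.sub_le
    have i1 : Integrable (fun p : E d × E d => quadCost τ p.1 p.2) (R.removed δ g) :=
      R.integrable_sum_weight δ g fun i => R.integrable_cost_plan hK hτ hμ hσ hadm i
    have i2 : Integrable (fun p : E d × E d => quadCost τ p.1 p.2) (R.added δ g) :=
      R.integrable_sum_weight δ g fun i => R.integrable_cost_prod hK hτ hμ hσ hadm i (R.next i)
    conv_rhs => rw [← R.sub_add_removed hδ g]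
    rw [newPlan, integral_add_measure i0 i2, integral_add_measure i0 i1, added, removed,
      R.integral_sum_weight hδ0 g fun i => R.integrable_cost_prod hK hτ hμ hσ hadm i (R.next i),
      R.integral_sum_weight hδ0 g fun i => R.integrable_cost_plan hK hτ hμ hσ hadm i]
    simp only [mul_sub, Finset.sum_sub_distrib]
    ring
  simp only [e, Finset.sum_add_distrib]
  congr 1
  rw [Finset.sum_comm, Finset.mul_sum]
  refine Finset.sum_congr rfl fun i _ => ?_
  rw [← Finset.sum_mul, ← Finset.mul_sum]
  simp

lemma integrable_exchange_cost (hK : IsConnectedWeightedGraph K) (hW : Measurable W) (hτ : 0 < τ)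
    (hadm : IsAdmissible K W τ μ σ γ h) :
    Integrable (fun x => ∑ i, h x (R.layer i) (R.layer (R.next i)) * R.dens (R.next i) x)
      volume := by
  have h1 : Integrable (fun x => τ / 2 *
      ∑ g, ∑ g', h x g g' * R.exchange τ x g g' * K g g' * Real.exp (-W x)) volume :=
    (integrable_finsetSum _ fun g _ => integrable_finsetSum _ fun g' _ =>
      integrable_mul_of_memLp hW (hK.nonneg g g') (hadm.memLp g g')
        (R.memLp_exchange hK hW hτ g g')).const_mul _
  refine h1.congr (Filter.Eventually.of_forall fun x => ?_)
  beta_reduce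
  rw [R.sum_mul_exchange hK.symm hτ hadm.antisymm]
  have := hτ.ne'
  field_simp

/-- The energy is a quadratic polynomial in `δ`. Only its linear coefficient matters, and there the
`τ / 2` from the square cancels the `2 / τ` of `sum_mul_exchange`. -/
lemma exists_energy_newExchange (hK : IsConnectedWeightedGraph K) (hW : Measurable W) (hτ : 0 < τ)
    (hadm : IsAdmissible K W τ μ σ γ h) : ∃ Q : ℝ, ∀ δ : ℝ,
    ∑ g, ∑ g', ∫ x, τ / 4 * (R.newExchange τ h δ x g g' ^ 2 * K g g' * Real.exp (-W x)) =
      (∑ g, ∑ g', ∫ x, τ / 4 * (h x g g' ^ 2 * K g g' * Real.exp (-W x))) +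
      δ * (∫ x, ∑ i, h x (R.layer i) (R.layer (R.next i)) * R.dens (R.next i) x) +
      δ ^ 2 * Q := by
  have i1 : ∀ g g', Integrable (fun x => h x g g' * R.exchange τ x g g' * K g g' *
      Real.exp (-W x)) volume := fun g g' => integrable_mul_of_memLp hW (hK.nonneg g g')
    (hadm.memLp g g') (R.memLp_exchange hK hW hτ g g')
  have i2 : ∀ g g', Integrable (fun x => R.exchange τ x g g' * R.exchange τ x g g' * K g g' *
      Real.exp (-W x)) volume := fun g g' => integrable_mul_of_memLp hW (hK.nonneg g g')
    (R.memLp_exchange hK hW hτ g g') (R.memLp_exchange hK hW hτ g g')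
  refine ⟨∑ g, ∑ g', τ / 4 * ∫ x, R.exchange τ x g g' * R.exchange τ x g g' * K g g' *
    Real.exp (-W x), fun δ => ?_⟩
  have e1 : ∫ x, ∑ i, h x (R.layer i) (R.layer (R.next i)) * R.dens (R.next i) x =
      ∑ g, ∑ g', τ / 2 * ∫ x, h x g g' * R.exchange τ x g g' * K g g' * Real.exp (-W x) := by
    simp only [← Finset.mul_sum]
    have : ∀ g, ∑ g', ∫ x, h x g g' * R.exchange τ x g g' * K g g' * Real.exp (-W x) =
        ∫ x, ∑ g', h x g g' * R.exchange τ x g g' * K g g' * Real.exp (-W x) := fun g =>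
      (integral_finsetSum _ fun g' _ => i1 g g').symm
    simp only [this]
    rw [← integral_finsetSum _ fun g _ => integrable_finsetSum _ fun g' _ => i1 g g',
      ← integral_const_mul]
    congr 1; ext x
    rw [R.sum_mul_exchange hK.symm hτ hadm.antisymm]
    have := hτ.ne'
    field_simp
  rw [e1]
  simp only [Finset.mul_sum, ← Finset.sum_add_distrib]
  refine Finset.sum_congr rfl fun g _ => Finset.sum_congr rfl fun g' _ => ?_
  have e2 : ∀ x, τ / 4 * (R.newExchange τ h δ x g g' ^ 2 * K g g' * Real.exp (-W x)) =
      τ / 4 * (h x g g' ^ 2 * K g g' * Real.exp (-W x)) +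
      δ * (τ / 2) * (h x g g' * R.exchange τ x g g' * K g g' * Real.exp (-W x)) +
      δ ^ 2 * (τ / 4) * (R.exchange τ x g g' * R.exchange τ x g g' * K g g' *
        Real.exp (-W x)) := fun x => by unfold newExchange; ring
  have i3 : Integrable (fun x => τ / 4 * (h x g g' ^ 2 * K g g' * Real.exp (-W x)) +
      δ * (τ / 2) * (h x g g' * R.exchange τ x g g' * K g g' * Real.exp (-W x))) volume :=
    ((hadm.integrable_energy hK hW g g').const_mul _).add ((i1 g g').const_mul _)
  simp only [e2]
  rw [integral_add i3 ((i2 g g').const_mul _), integral_add ((hadm.integrable_energy hK hW g g').const_mul _)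
    ((i1 g g').const_mul _), integral_const_mul (δ * (τ / 2)), integral_const_mul (δ ^ 2 * (τ / 4))]
  ring

/-- First variation of the cost along a rearrangement. -/
theorem first_variation_nonneg (hK : IsConnectedWeightedGraph K) (hW : Measurable W) (hτ : 0 < τ)
    (hμ : IsP2 μ) (hσ : IsP2 σ) (hadm : IsAdmissible K W τ μ σ γ h)
    (hopt : ∀ γ' h', IsAdmissible K W τ μ σ γ' h' →
      realCost K W τ γ h ≤ realCost K W τ γ' h') :
    0 ≤ (∑ i, ((∫ p, quadCost τ p.1 p.2 ∂((R.fst i).prod (R.snd (R.next i)))) -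
        ∫ p, quadCost τ p.1 p.2 ∂(R.plan i))) +
      ∫ x, ∑ i, h x (R.layer i) (R.layer (R.next i)) * R.dens (R.next i) x := by
  have := hμ.prob
  set L := (∑ i, ((∫ p, quadCost τ p.1 p.2 ∂((R.fst i).prod (R.snd (R.next i)))) -
        ∫ p, quadCost τ p.1 p.2 ∂(R.plan i))) +
      ∫ x, ∑ i, h x (R.layer i) (R.layer (R.next i)) * R.dens (R.next i) x with hL
  obtain ⟨Q, hQ⟩ := R.exists_energy_newExchange hK hW hτ hadm
  set δ₀ : ℝ := 1 / (Fintype.card ι * R.C + 1) with hδ₀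
  have hc : (0 : ℝ) ≤ Fintype.card ι * R.C := by positivity
  have hδ₀pos : 0 < δ₀ := by positivity
  have key : ∀ δ : ℝ, 0 < δ → δ ≤ δ₀ → 0 ≤ δ * L + δ ^ 2 * Q := by
    intro δ h0 h1
    have hδ : ENNReal.ofReal δ * (Fintype.card ι * R.C) ≤ 1 := by
      have e : (Fintype.card ι * R.C : ℝ≥0∞) = ENNReal.ofReal (Fintype.card ι * R.C) := by
        rw [ENNReal.ofReal_mul (by positivity)]
        simp
      rw [e, ← ENNReal.ofReal_mul h0.le, ← ENNReal.ofReal_one]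
      refine ENNReal.ofReal_le_ofReal ?_
      calc δ * (Fintype.card ι * R.C) ≤ δ₀ * (Fintype.card ι * R.C + 1) := by gcongr; linarith
        _ = 1 := by rw [hδ₀]; field_simp
    have := hopt _ _ (R.isAdmissible_new hK hW hτ hadm h0.le hδ)
    unfold realCost at this
    rw [R.sum_integral_newPlan hK hτ hμ hσ hadm h0.le hδ, hQ δ] at this
    rw [hL]
    linarith
  by_contra hneg
  push Not at hneg
  -- So small that the quadratic term cannot compensate a negative linear term.
  set δ := min δ₀ (-L / (2 * (|Q| + 1))) with hδ
  have hp : 0 < -L / (2 * (|Q| + 1)) := by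
    have := abs_nonneg Q
    exact div_pos (by linarith) (by linarith)
  have hδpos : 0 < δ := lt_min hδ₀pos hp
  have h1 := key δ hδpos (min_le_left _ _)
  have h2 : δ * (2 * (|Q| + 1)) ≤ -L := by
    have : δ ≤ -L / (2 * (|Q| + 1)) := min_le_right _ _
    rwa [le_div_iff₀ (by have := abs_nonneg Q; linarith)] at this
  have h3 : 0 ≤ L + δ * Q := by
    have : 0 ≤ δ * (L + δ * Q) := by linarith
    exact nonneg_of_mul_nonneg_right this hδpos
  have h4 : δ * Q ≤ δ * |Q| := mul_le_mul_of_nonneg_left (le_abs_self Q) hδpos.le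
  nlinarith

end Rearrangement

open scoped NNReal ENNReal

/-! ### Small pieces of a plan near almost every point. -/

section Localization

variable {d : ℕ}

/-- The Radon-Nikodym derivative obeys the bounds only almost everywhere; taking its minimum with
the indicator makes them hold at every point without changing the measure. -/
lemma exists_bounded_density {ρ : Measure (E d)} [IsFiniteMeasure ρ] {B : ℝ≥0} {S : Set (E d)}
    (hS : MeasurableSet S) (hρ : ρ ≤ (B : ℝ≥0∞) • (volume : Measure (E d)).restrict S) :
    ∃ r : E d → ℝ, Measurable r ∧ (∀ x, 0 ≤ r x) ∧ (∀ x, r x ≤ B) ∧ (∀ x, r x ≠ 0 → x ∈ S) ∧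
      ρ = volume.withDensity fun x => ENNReal.ofReal (r x) := by
  have hac : ρ ≪ volume :=
    ((Measure.absolutelyContinuous_of_le hρ).trans (Measure.smul_absolutelyContinuous)).trans
      Measure.restrict_le_self.absolutelyContinuous
  have hle : ρ.rnDeriv volume ≤ᵐ[volume] S.indicator fun _ => (B : ℝ≥0∞) := by
    refine ae_le_of_forall_setLIntegral_le_of_sigmaFinite (Measure.measurable_rnDeriv _ _) ?_
    intro A hA _
    rw [Measure.setLIntegral_rnDeriv hac, setLIntegral_indicator hS, setLIntegral_const]
    have := hρ A
    rwa [Measure.smul_apply, Measure.restrict_apply hA, smul_eq_mul, Set.inter_comm] at this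
  refine ⟨fun x => (min (ρ.rnDeriv volume x) (S.indicator (fun _ => (B : ℝ≥0∞)) x)).toReal,
    ?_, fun x => ENNReal.toReal_nonneg, fun x => ?_, fun x hx => ?_, ?_⟩
  · exact ((Measure.measurable_rnDeriv _ _).min (measurable_const.indicator hS)).ennreal_toReal
  · refine ENNReal.toReal_le_of_le_ofReal B.2 ((min_le_right _ _).trans ?_)
    refine (Set.indicator_le_self _ _ _).trans ?_
    simp
  · by_contra hn
    simp [hn] at hx
  · conv_lhs => rw [← Measure.withDensity_rnDeriv_eq ρ volume hac]
    refine withDensity_congr_ae ?_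
    filter_upwards [hle, Measure.rnDeriv_ne_top ρ volume] with x hx hx'
    rw [min_eq_left hx, ENNReal.ofReal_toReal hx']

/-- A normalised piece of a plan that is concentrated on a given set of positive measure and whose
second marginal has a bounded density with respect to Lebesgue measure. -/
lemma exists_piece {W : E d → ℝ} (hW : Measurable W) {ν : Measure (E d × E d)} [IsFiniteMeasure ν]
    (hac : ν.map Prod.snd ≪ volume) {N : Set (E d × E d)} (hN : MeasurableSet N) (hpos : ν N ≠ 0) :
    ∃ (θ : Measure (E d × E d)) (r : E d → ℝ) (C M : ℝ≥0), IsProbabilityMeasure θ ∧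
      θ ≤ (C : ℝ≥0∞) • ν ∧ (∀ᵐ p ∂θ, p ∈ N) ∧
      θ.map Prod.snd = (volume.withDensity fun x => ENNReal.ofReal (r x)) ∧ Measurable r ∧
      (∀ x, 0 ≤ r x) ∧ (∀ x, r x ≤ M) ∧ ∀ x, r x ≠ 0 → W x ≤ M := by
  set F := (ν.map Prod.snd).rnDeriv volume with hF
  have hFm : Measurable F := Measure.measurable_rnDeriv _ _
  -- These sets exhaust almost every target point, so one of them retains positive mass of `N`.
  let S : ℕ → Set (E d) := fun n => {y | W y ≤ n ∧ F y ≤ n}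
  have hSm : ∀ n, MeasurableSet (S n) := fun n =>
    (measurableSet_le hW measurable_const).inter (measurableSet_le hFm measurable_const)
  have hcover : ∀ᵐ y ∂(ν.map Prod.snd), ∃ n, y ∈ S n := by
    refine hac.ae_le ?_
    filter_upwards [Measure.rnDeriv_ne_top (ν.map Prod.snd) volume] with y hy
    obtain ⟨n₁, h₁⟩ := exists_nat_ge (W y)
    obtain ⟨n₂, h₂⟩ := ENNReal.exists_nat_gt hy
    refine ⟨max n₁ n₂, h₁.trans (by exact_mod_cast le_max_left _ _), h₂.le.trans ?_⟩
    exact_mod_cast le_max_right _ _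
  have hex : ∃ n, ν (N ∩ Prod.snd ⁻¹' S n) ≠ 0 := by
    by_contra hcon
    push Not at hcon
    apply hpos
    have h1 : ν (⋃ n, N ∩ Prod.snd ⁻¹' S n) = 0 := measure_iUnion_null hcon
    rw [measure_eq_zero_iff_ae_notMem] at h1 ⊢
    filter_upwards [h1, ae_of_ae_map measurable_snd.aemeasurable hcover] with q hq1 hq2 hq3
    obtain ⟨n, hn⟩ := hq2
    exact hq1 (Set.mem_iUnion.2 ⟨n, hq3, hn⟩)
  obtain ⟨n, hn⟩ := hex
  set N' := N ∩ Prod.snd ⁻¹' S n with hN'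
  have hN'm : MeasurableSet N' := hN.inter (measurable_snd (hSm n))
  have htop : (ν N')⁻¹ ≠ ⊤ := ENNReal.inv_ne_top.2 hn
  set C : ℝ≥0 := ((ν N')⁻¹).toNNReal with hC
  have hC' : (C : ℝ≥0∞) = (ν N')⁻¹ := ENNReal.coe_toNNReal htop
  set θ := (C : ℝ≥0∞) • ν.restrict N' with hθ
  have hprob : IsProbabilityMeasure θ := by
    refine ⟨?_⟩
    rw [hθ, Measure.smul_apply, Measure.restrict_apply_univ, hC', smul_eq_mul,
      ENNReal.inv_mul_cancel hn (measure_ne_top _ _)]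
  have hθN : ∀ᵐ p ∂θ, p ∈ N := by
    refine Measure.ae_smul_measure ?_ _
    filter_upwards [ae_restrict_mem hN'm] with p hp using hp.1
  have hle : θ.map Prod.snd ≤ ((C * n : ℝ≥0) : ℝ≥0∞) • (volume : Measure (E d)).restrict (S n) := by
    refine Measure.le_iff.2 fun A hA => ?_
    have h2 : (ν.map Prod.snd) (A ∩ S n) ≤ n * volume (A ∩ S n) := by
      rw [← Measure.setLIntegral_rnDeriv hac, ← setLIntegral_const]
      exact setLIntegral_mono measurable_const fun y hy => hy.2.2
    rw [Measure.map_apply measurable_snd hA, hθ, Measure.smul_apply, Measure.smul_apply,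
      Measure.restrict_apply (measurable_snd hA), Measure.restrict_apply hA, smul_eq_mul,
      smul_eq_mul]
    rw [Measure.map_apply measurable_snd (hA.inter (hSm n))] at h2
    calc (C : ℝ≥0∞) * ν (Prod.snd ⁻¹' A ∩ N')
        ≤ C * ν (Prod.snd ⁻¹' (A ∩ S n)) := by
          gcongr
          exact fun q hq => ⟨hq.1, hq.2.2⟩
      _ ≤ C * (n * volume (A ∩ S n)) := by gcongr
      _ = _ := by push_cast; ring
  have := Measure.isProbabilityMeasure_map (μ := θ) (f := Prod.snd) measurable_snd.aemeasurable
  obtain ⟨r, hr1, hr2, hr3, hr4, hr5⟩ := exists_bounded_density (hSm n) hle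
  refine ⟨θ, r, C, max (C * n) n, hprob, ?_, hθN, hr5, hr1, hr2, fun x => (hr3 x).trans ?_,
    fun x hx => (hr4 x hx).1.trans ?_⟩
  · refine Measure.le_iff.2 fun A _ => ?_
    rw [hθ, Measure.smul_apply, Measure.smul_apply]
    gcongr
    exact Measure.restrict_le_self
  · exact_mod_cast le_max_left _ _
  · exact_mod_cast le_max_right _ _

/-- Points near which the plan has mass, also when the exchange map is required to be close to its
value at the point. -/
def goodPoints {G : Type*} (K : G → G → ℝ) (h : E d → G → G → ℝ) (ν : Measure (E d × E d)) :
    Set (E d × E d) :=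
  {p | ∀ ε > 0, ∃ T : Set (E d), MeasurableSet T ∧ ν (Metric.ball p.1 ε ×ˢ T) ≠ 0 ∧
    ∀ y ∈ T, dist y p.2 < ε ∧ ∀ a b, 0 < K a b → |h y a b - h p.2 a b| < ε}

/-- In place of Lebesgue points, the plan is pushed to the graph of `p ↦ (p, h(p.2))`: almost every
image point lies in the support of the pushforward, so all its neighbourhoods have positive mass.
Absolute continuity of the second marginal allows `h` to be replaced by a measurable version. -/
lemma ae_mem_goodPoints {G : Type*} [Fintype G] {K : G → G → ℝ} {h : E d → G → G → ℝ}
    (hh : ∀ a b, 0 < K a b → AEMeasurable (fun x => h x a b) volume)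
    {ν : Measure (E d × E d)} [IsFiniteMeasure ν] (hac : ν.map Prod.snd ≪ volume) :
    ∀ᵐ p ∂ν, p ∈ goodPoints K h ν := by
  classical
  have hmk : ∀ a b, ∃ f : E d → ℝ, Measurable f ∧
      ∀ᵐ x, 0 < K a b → h x a b = f x := by
    intro a b
    by_cases hab : 0 < K a b
    · exact ⟨_, (hh a b hab).measurable_mk, (hh a b hab).ae_eq_mk.mono fun x hx _ => hx⟩
    · exact ⟨0, measurable_zero, Filter.Eventually.of_forall fun x hx => absurd hx hab⟩
  choose f hfm hf using hmk
  have hf' : ∀ᵐ x, ∀ a b, 0 < K a b → h x a b = f a b x :=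
    ae_all_iff.2 fun a => ae_all_iff.2 fun b => hf a b
  obtain ⟨T₀, hT₀ae, hT₀m, hT₀⟩ := hf'.exists_measurable_mem
  have hT₀ν : ∀ᵐ p ∂ν, p.2 ∈ T₀ := ae_of_ae_map measurable_snd.aemeasurable (hac.ae_le hT₀ae)
  let F : E d × E d → (E d × E d) × (G → G → ℝ) := fun p => (p, fun a b => f a b p.2)
  have hF : Measurable F := by
    refine measurable_id.prodMk ?_
    refine measurable_pi_lambda _ fun a => measurable_pi_lambda _ fun b => ?_
    exact (hfm a b).comp measurable_snd
  have hsupp : ∀ᵐ p ∂ν, F p ∈ (ν.map F).support :=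
    ae_of_ae_map hF.aemeasurable Measure.support_mem_ae
  filter_upwards [hT₀ν, hsupp] with p hp1 hp2 ε hε
  have hball := (Measure.mem_support_iff_forall _).1 hp2 _ (Metric.ball_mem_nhds _ hε)
  rw [Measure.map_apply hF Metric.isOpen_ball.measurableSet] at hball
  refine ⟨{y | y ∈ T₀ ∧ dist y p.2 < ε ∧ dist (fun a b => f a b y) (fun a b => f a b p.2) < ε},
    ?_, ?_, ?_⟩
  · refine hT₀m.inter (MeasurableSet.inter ?_ ?_)
    · exact Metric.isOpen_ball.measurableSet
    · have : Measurable fun y => (fun a b => f a b y : G → G → ℝ) :=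
        measurable_pi_lambda _ fun a => measurable_pi_lambda _ fun b => hfm a b
      exact measurableSet_lt (this.dist measurable_const) measurable_const
  · refine (hball.trans_le (measure_mono_ae ?_)).ne'
    filter_upwards [hT₀ν] with q hq hqb
    have hqb' : dist (F q) (F p) < ε := hqb
    simp only [F, Prod.dist_eq, max_lt_iff] at hqb'
    exact ⟨hqb'.1.1, hq, hqb'.1.2, hqb'.2⟩
  · rintro y ⟨hy1, hy2, hy3⟩
    refine ⟨hy2, fun a b hab => ?_⟩
    rw [dist_pi_lt_iff hε] at hy3
    have := (dist_pi_lt_iff hε).1 (hy3 a) b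
    rw [hT₀ y hy1 a b hab, hT₀ p.2 hp1 a b hab]
    exact this

end Localization

/-! ### Cyclical monotonicity with jumps between layers. -/

section Cyclic

variable {d : ℕ} {G : Type*} [Fintype G] [MeasurableSpace G] {K : G → G → ℝ} {W : E d → ℝ} {τ : ℝ}
  {μ σ : Measure (E d × G)} {γ : G → Measure (E d × E d)} {h : E d → G → G → ℝ}

lemma integral_le_of_ae_le {α : Type*} [MeasurableSpace α] {ν : Measure α} [IsProbabilityMeasure ν]
    {f : α → ℝ} (hf : Integrable f ν) {a : ℝ} (h : ∀ᵐ x ∂ν, f x ≤ a) : ∫ x, f x ∂ν ≤ a := by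
  simpa using integral_mono_ae hf (integrable_const a) h

lemma le_integral_of_ae_le {α : Type*} [MeasurableSpace α] {ν : Measure α} [IsProbabilityMeasure ν]
    {f : α → ℝ} (hf : Integrable f ν) {a : ℝ} (h : ∀ᵐ x ∂ν, a ≤ f x) : a ≤ ∫ x, f x ∂ν := by
  simpa using integral_mono_ae (integrable_const a) hf h

/-- Cyclical monotonicity of an optimal pair, with jumps between the layers. -/
theorem cyclic_nonneg (hK : IsConnectedWeightedGraph K) (hW : Measurable W) (hτ : 0 < τ)
    (hμ : IsP2 μ) (hσ : IsP2 σ) (hac : ∀ g, (γ g).map Prod.snd ≪ volume)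
    (hadm : IsAdmissible K W τ μ σ γ h)
    (hopt : ∀ γ' h', IsAdmissible K W τ μ σ γ' h' →
      realCost K W τ γ h ≤ realCost K W τ γ' h')
    {ι : Type*} [Fintype ι] (next : Equiv.Perm ι) (layer : ι → G) (p : ι → E d × E d)
    (hp : ∀ i, p i ∈ goodPoints K h (γ (layer i)))
    (hedge : ∀ i, layer i = layer (next i) ∨ 0 < K (layer i) (layer (next i))) :
    0 ≤ ∑ i, (quadCost τ (p i).1 (p (next i)).2 - quadCost τ (p i).1 (p i).2 +
      h (p (next i)).2 (layer i) (layer (next i))) := by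
  have := hμ.prob
  have := fun g => hadm.isFiniteMeasure g
  -- Every index loses at most `ε` in the new transport cost, `ε` in the old one, and `ε` in the
  -- value of `h`.
  suffices hε : ∀ ε > 0, -(3 * Fintype.card ι * ε) ≤
      ∑ i, (quadCost τ (p i).1 (p (next i)).2 - quadCost τ (p i).1 (p i).2 +
        h (p (next i)).2 (layer i) (layer (next i))) by
    by_contra hneg
    push Not at hneg
    set L := ∑ i, (quadCost τ (p i).1 (p (next i)).2 - quadCost τ (p i).1 (p i).2 +
        h (p (next i)).2 (layer i) (layer (next i))) with hL
    have hc : (0 : ℝ) < 3 * Fintype.card ι + 1 := by positivity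
    have h1 := hε (-L / (3 * Fintype.card ι + 1)) (div_pos (by linarith) hc)
    have h2 : 3 * Fintype.card ι * (-L / (3 * Fintype.card ι + 1)) < -L := by
      rw [mul_div_assoc', div_lt_iff₀ hc]
      nlinarith
    linarith
  intro ε hε
  have hcont : ∃ η > 0, η ≤ ε ∧ ∀ i j, ∀ x y, dist x (p i).1 < η → dist y (p j).2 < η →
      |quadCost τ x y - quadCost τ (p i).1 (p j).2| < ε := by
    have h1 : ∀ k : ι × ι, ∃ η > 0, ∀ x y, dist x (p k.1).1 < η → dist y (p k.2).2 < η →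
        |quadCost τ x y - quadCost τ (p k.1).1 (p k.2).2| < ε := by
      intro k
      obtain ⟨η, hη, hη'⟩ := Metric.continuous_iff.1 (continuous_quadCost (d := d) τ)
        ((p k.1).1, (p k.2).2) ε hε
      refine ⟨η, hη, fun x y hx hy => ?_⟩
      exact hη' (x, y) (by rw [Prod.dist_eq]; exact max_lt hx hy)
    choose η hη hη' using h1
    obtain ⟨η₀, hη₀, hle⟩ : ∃ η₀ > 0, ∀ k, η₀ ≤ η k := by
      rcases isEmpty_or_nonempty (ι × ι) with he | he
      · exact ⟨1, one_pos, fun k => he.elim k⟩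
      · obtain ⟨k₀, hk₀⟩ := Finite.exists_min η
        exact ⟨η k₀, hη k₀, hk₀⟩
    refine ⟨min η₀ ε, lt_min hη₀ hε, min_le_right _ _, fun i j x y hx hy => ?_⟩
    exact hη' (i, j) x y (hx.trans_le ((min_le_left _ _).trans (hle (i, j))))
      (hy.trans_le ((min_le_left _ _).trans (hle (i, j))))
  obtain ⟨η, hη, hηε, hclose⟩ := hcont
  choose T hTm hTpos hT using fun i => hp i η hη
  choose θ r C M hprob hle hmem hsnd hrm hr0 hrM hrW using fun i =>
    exists_piece hW (hac (layer i)) (Metric.isOpen_ball.measurableSet.prod (hTm i)) (hTpos i)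
  have hM : ∀ i, (M i : ℝ) ≤ ∑ j, (M j : ℝ) := fun i =>
    Finset.single_le_sum (f := fun j => (M j : ℝ)) (fun j _ => (M j).2) (Finset.mem_univ i)
  let R : Rearrangement K W γ ι :=
    { next := next
      layer := layer
      plan := θ
      dens := r
      C := ∑ j, C j
      M := ∑ j, (M j : ℝ)
      prob := hprob
      plan_le := fun i => (hle i).trans (by
        refine Measure.le_iff.2 fun A _ => ?_
        rw [Measure.smul_apply, Measure.smul_apply]
        gcongr
        exact Finset.single_le_sum (f := C) (fun j _ => zero_le) (Finset.mem_univ i))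
      map_snd := hsnd
      measurable_dens := hrm
      dens_nonneg := hr0
      dens_le := fun i x => (hrM i x).trans (hM i)
      potential_le := fun i x hx => (hrW i x hx).trans (hM i)
      edge := hedge }
  have hvar := R.first_variation_nonneg hK hW hτ hμ hσ hadm hopt
  have hfst : ∀ i, ∀ᵐ x ∂(R.fst i), dist x (p i).1 < η := by
    intro i
    refine (ae_map_iff measurable_fst.aemeasurable Metric.isOpen_ball.measurableSet).2 ?_
    filter_upwards [hmem i] with q hq using hq.1
  have hsnd' : ∀ i, ∀ᵐ y ∂(R.snd i), y ∈ T i := by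
    intro i
    refine (ae_map_iff measurable_snd.aemeasurable (hTm i)).2 ?_
    filter_upwards [hmem i] with q hq using hq.2
  have b1 : ∀ i, ∫ q, quadCost τ q.1 q.2 ∂((R.fst i).prod (R.snd (next i))) ≤
      quadCost τ (p i).1 (p (next i)).2 + ε := by
    intro i
    have := R.isProbabilityMeasure_fst
    have := R.isProbabilityMeasure_snd
    refine integral_le_of_ae_le (R.integrable_cost_prod hK hτ hμ hσ hadm i (next i)) ?_
    filter_upwards [Measure.quasiMeasurePreserving_fst.ae (hfst i),
      Measure.quasiMeasurePreserving_snd.ae (hsnd' (next i))] with q hq1 hq2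
    have := abs_lt.1 (hclose i (next i) q.1 q.2 hq1 (hT _ _ hq2).1)
    linarith
  have b2 : ∀ i, quadCost τ (p i).1 (p i).2 - ε ≤ ∫ q, quadCost τ q.1 q.2 ∂(R.plan i) := by
    intro i
    have := hprob i
    refine le_integral_of_ae_le (ν := θ i) (R.integrable_cost_plan hK hτ hμ hσ hadm i) ?_
    filter_upwards [hmem i] with q hq
    have := abs_lt.1 (hclose i i q.1 q.2 hq.1 (hT _ _ hq.2).1)
    linarith
  have b3 : ∫ x, ∑ i, h x (R.layer i) (R.layer (R.next i)) * R.dens (R.next i) x ≤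
      ∑ i, (h (p (next i)).2 (layer i) (layer (next i)) + ε) := by
    have e1 : ∫ x, ∑ i, (h (p (next i)).2 (layer i) (layer (next i)) + ε) * R.dens (next i) x =
        ∑ i, (h (p (next i)).2 (layer i) (layer (next i)) + ε) := by
      rw [integral_finsetSum _ fun i _ => (R.integrable_dens _).const_mul _]
      refine Finset.sum_congr rfl fun i _ => ?_
      rw [integral_const_mul, R.integral_dens, mul_one]
    rw [← e1]
    refine integral_mono_ae (R.integrable_exchange_cost hK hW hτ hadm)
      (integrable_finsetSum _ fun i _ => (R.integrable_dens _).const_mul _) ?_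
    -- The exchange takes place only over `T (next i)`, where `h` is close to its value at the
    -- chosen target point.
    have hvol : ∀ i, ∀ᵐ x, ENNReal.ofReal (R.dens (next i) x) ≠ 0 → x ∈ T (next i) := by
      intro i
      have := hsnd' (next i)
      rwa [Rearrangement.snd, R.map_snd, ae_withDensity_iff
        (R.measurable_dens _).ennreal_ofReal] at this
    filter_upwards [ae_all_iff.2 hvol] with x hx
    refine Finset.sum_le_sum fun i _ => ?_
    rcases (R.dens_nonneg (next i) x).eq_or_lt with h0 | h0
    · change h x (layer i) (layer (next i)) * R.dens (next i) x ≤ _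
      rw [← h0]; simp
    · refine mul_le_mul_of_nonneg_right ?_ h0.le
      have hxT := hT _ _ (hx i (by simpa using h0))
      change h x (layer i) (layer (next i)) ≤ _
      rcases hedge i with he | he
      · have hz : ∀ y g, h y g g = 0 := fun y g => by
          have := hadm.antisymm y g g; linarith
        rw [← he, hz, hz]; linarith
      · have := abs_lt.1 (hxT.2 _ _ he)
        linarith
  have b12 : ∑ i, ((∫ q, quadCost τ q.1 q.2 ∂((R.fst i).prod (R.snd (R.next i)))) -
        ∫ q, quadCost τ q.1 q.2 ∂(R.plan i)) ≤
      ∑ i, (quadCost τ (p i).1 (p (next i)).2 - quadCost τ (p i).1 (p i).2 + 2 * ε) :=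
    Finset.sum_le_sum fun i _ => by
      have := b1 i
      have := b2 i
      change (∫ q, quadCost τ q.1 q.2 ∂((R.fst i).prod (R.snd (next i)))) - _ ≤ _
      linarith
  simp only [Finset.sum_add_distrib, Finset.sum_const, nsmul_eq_mul, Finset.card_univ] at b12 b3 ⊢
  linarith

end Cyclic

/-! ### Potentials from the absence of negative cycles. -/

section FeasiblePotential

variable {V : Type*} {edge : V → V → Prop} {w : V → V → ℝ}

/-- The potential is the infimum of walk lengths from a base vertex, and the inequality holds since
a walk can be prolonged by an edge. The infimum is finite because a fixed return walk closes any
walk into a cycle of nonnegative length. -/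
lemma exists_feasible_potential
    (hcyc : ∀ (n : ℕ) (f : ℕ → V), (∀ i < n, edge (f i) (f (i + 1))) → edge (f n) (f 0) →
      0 ≤ ∑ i ∈ Finset.range n, w (f i) (f (i + 1)) + w (f n) (f 0))
    (hconn : ∀ a b, Relation.TransGen edge a b) :
    ∃ D : V → ℝ, ∀ a b, edge a b → D b ≤ D a + w a b := by
  rcases isEmpty_or_nonempty V with hV | ⟨⟨o⟩⟩
  · exact ⟨fun _ => 0, fun a => hV.elim a⟩
  -- Walks with at least one edge, so that a closed walk is exactly a cycle in the sense of `hcyc`.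
  let P : V → V → ℝ → Prop := fun a b s => ∃ (n : ℕ) (f : ℕ → V), f 0 = a ∧ f (n + 1) = b ∧
    (∀ i < n + 1, edge (f i) (f (i + 1))) ∧ s = ∑ i ∈ Finset.range (n + 1), w (f i) (f (i + 1))
  have hsingle : ∀ a b, edge a b → P a b (w a b) := by
    intro a b hab
    refine ⟨0, fun i => if i = 0 then a else b, by simp, by simp, fun i hi => ?_, by simp⟩
    obtain rfl : i = 0 := by omega
    simpa using hab
  have hstep : ∀ a b c s, P a b s → edge b c → P a c (s + w b c) := by
    rintro a b c s ⟨n, f, h0, h1, h2, rfl⟩ hbc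
    refine ⟨n + 1, fun i => if i ≤ n + 1 then f i else c, by simpa using h0, by simp,
      fun i hi => ?_, ?_⟩
    · rcases Nat.lt_succ_iff_lt_or_eq.1 hi with hi' | rfl
      · have e1 : i ≤ n + 1 := by omega
        have e2 : i + 1 ≤ n + 1 := by omega
        simp only [e1, e2, if_true]
        exact h2 i hi'
      · simpa [h1] using hbc
    · have e : ∑ i ∈ Finset.range (n + 1), w (f i) (f (i + 1)) = ∑ i ∈ Finset.range (n + 1),
          w (if i ≤ n + 1 then f i else c) (if i + 1 ≤ n + 1 then f (i + 1) else c) := by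
        refine Finset.sum_congr rfl fun i hi => ?_
        have hi' := Finset.mem_range.1 hi
        have e1 : i ≤ n + 1 := by omega
        have e2 : i + 1 ≤ n + 1 := by omega
        simp only [e1, e2, if_true]
      rw [Finset.sum_range_succ _ (n + 1), e]
      simp [h1]
  have htrans : ∀ a b c s, P a b s → Relation.TransGen edge b c →
      ∃ t, ∀ s', P a b s' → P a c (s' + t) := by
    intro a b c s _ hbc
    induction hbc with
    | single h => exact ⟨_, fun s' hs' => hstep _ _ _ _ hs' h⟩
    | tail _ h ih =>
      obtain ⟨t, ht⟩ := ih
      exact ⟨t + w _ _, fun s' hs' => by rw [← add_assoc]; exact hstep _ _ _ _ (ht s' hs') h⟩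
  have hex : ∀ a b, ∃ s, P a b s := by
    intro a b
    induction hconn a b with
    | single h => exact ⟨_, hsingle _ _ h⟩
    | tail _ h ih =>
      obtain ⟨s, hs⟩ := ih
      exact ⟨_, hstep _ _ _ _ hs h⟩
  have hclosed : ∀ s, P o o s → 0 ≤ s := by
    rintro s ⟨n, f, h0, h1, h2, rfl⟩
    rw [Finset.sum_range_succ, h1, ← h0]
    refine hcyc n f (fun i hi => h2 i (by omega)) ?_
    have := h2 n (by omega)
    rwa [h1, ← h0] at this
  have hbdd : ∀ b, BddBelow {s | P o b s} := by
    intro b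
    obtain ⟨s, hs⟩ := hex o b
    obtain ⟨t, ht⟩ := htrans o b o s hs (hconn b o)
    refine ⟨-t, fun s' hs' => ?_⟩
    have := hclosed _ (ht s' hs')
    linarith
  refine ⟨fun b => sInf {s | P o b s}, fun a b hab => ?_⟩
  rw [← sub_le_iff_le_add]
  refine le_csInf (hex o a) fun s hs => ?_
  rw [sub_le_iff_le_add]
  exact csInf_le (hbdd b) (hstep _ _ _ _ hs hab)

end FeasiblePotential

/-! ### From values on conull sets to a finite `c`-concave function. -/

section Conull

variable {d : ℕ}

/-- The point reflection at `y` preserves Lebesgue measure, so a conull set meets its own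
reflection: every point is a midpoint of two points of the set. -/
lemma exists_add_eq_add_self {S : Set (E d)} (hS : ∀ᵐ x, x ∈ S) (y : E d) :
    ∃ z ∈ S, ∃ z' ∈ S, z + z' = y + y := by
  have h1 : ∀ᵐ x : E d, (y + y) - x ∈ S :=
    (Measure.measurePreserving_sub_left volume (y + y)).quasiMeasurePreserving.ae hS
  obtain ⟨z, hz, hz'⟩ := (hS.and h1).exists
  exact ⟨z, hz, _, hz', by abel⟩

lemma norm_sub_sq_midpoint {x y z z' : E d} (h : z + z' = y + y) :
    ‖x - y‖ ^ 2 = 1 / 2 * ‖x - z‖ ^ 2 + 1 / 2 * ‖x - z'‖ ^ 2 - 1 / 4 * ‖z - z'‖ ^ 2 := by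
  have h1 := parallelogram_law_with_norm ℝ (x - z) (x - z')
  have e1 : x - z + (x - z') = (2 : ℝ) • (x - y) := by
    rw [two_smul]
    have : x - z + (x - z') = x + x - (z + z') := by abel
    rw [this, h]; abel
  have e2 : x - z - (x - z') = -(z - z') := by abel
  rw [e1, e2, norm_smul, norm_neg] at h1
  simp only [Real.norm_ofNat] at h1
  nlinarith

lemma quadCost_midpoint (τ : ℝ) {x y z z' : E d} (h : z + z' = y + y) :
    quadCost τ x y = 1 / 2 * quadCost τ x z + 1 / 2 * quadCost τ x z' - 1 / 4 * quadCost τ z z' := by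
  unfold quadCost
  rw [norm_sub_sq_midpoint h]; ring

lemma quadCost_comm (τ : ℝ) (x y : E d) : quadCost τ x y = quadCost τ y x := by
  unfold quadCost; rw [norm_sub_rev]

/-- The Rockafellar-type infimum is the desired function once it is finite everywhere. By
`quadCost_midpoint`, bounds at two points imply a bound at their midpoint with an error independent
of the other variable. Conullness of the `y i` thus bounds the infimum, and conullness of the `x i`
bounds its `c`-transform. -/
lemma exists_cConcave_of_feasible (τ : ℝ) {I : Type*} {x y : I → E d} {D : I → ℝ}
    (hD : ∀ i j, D j ≤ D i + (quadCost τ (x i) (y j) - quadCost τ (x i) (y i)))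
    (hx : ∀ᵐ a, a ∈ Set.range x) (hy : ∀ᵐ a, a ∈ Set.range y) :
    ∃ φ : E d → ℝ, IsCConcave (quadCost τ) φ ∧ (∀ i, φ (y i) = D i) ∧
      ∀ i, (x i, y i) ∈ cSuperdiff (quadCost τ) φ := by
  have hI : Nonempty I := by
    obtain ⟨_, ⟨i, _⟩, _⟩ := exists_add_eq_add_self hx 0
    exact ⟨i⟩
  let F : E d → I → ℝ := fun b i => quadCost τ (x i) b - quadCost τ (x i) (y i) + D i
  have hF : ∀ b, BddBelow (Set.range (F b)) := by
    intro b
    obtain ⟨_, ⟨i, rfl⟩, _, ⟨j, rfl⟩, hij⟩ := exists_add_eq_add_self hy b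
    refine ⟨1 / 2 * D i + 1 / 2 * D j - 1 / 4 * quadCost τ (y i) (y j), ?_⟩
    rintro _ ⟨k, rfl⟩
    have h1 := hD k i
    have h2 := hD k j
    have h3 := quadCost_midpoint τ (x := x k) hij
    simp only [F]
    linarith
  let φ : E d → ℝ := fun b => ⨅ i, F b i
  have hφle : ∀ b i, φ b ≤ F b i := fun b i => ciInf_le (hF b) i
  have hφD : ∀ i, φ (y i) = D i := by
    intro i
    refine le_antisymm ((hφle _ i).trans (by simp [F])) (le_ciInf fun k => ?_)
    have := hD k i
    simp only [F]
    linarith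
  have hsup : ∀ i b, quadCost τ (x i) (y i) - φ (y i) ≤ quadCost τ (x i) b - φ b := by
    intro i b
    have h1 := hφle b i
    rw [hφD]
    simp only [F] at h1
    linarith
  have hη : ∀ a, BddBelow (Set.range fun b => quadCost τ a b - φ b) := by
    intro a
    obtain ⟨_, ⟨i, rfl⟩, _, ⟨j, rfl⟩, hij⟩ := exists_add_eq_add_self hx a
    refine ⟨1 / 2 * (quadCost τ (x i) (y i) - φ (y i)) + 1 / 2 * (quadCost τ (x j) (y j) - φ (y j))
      - 1 / 4 * quadCost τ (x i) (x j), ?_⟩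
    rintro _ ⟨b, rfl⟩
    have h1 := hsup i b
    have h2 := hsup j b
    have h3 := quadCost_midpoint τ (x := b) hij
    rw [quadCost_comm τ b a, quadCost_comm τ b, quadCost_comm τ b] at h3
    beta_reduce
    linarith
  refine ⟨φ, ⟨fun a => ⨅ b, (quadCost τ a b - φ b), fun b => ?_⟩, hφD,
    fun i => mem_cSuperdiff_iff.2 (hsup i)⟩
  rw [iInf_coe_eq_coe_iff]
  refine ⟨fun a => ?_, fun m hm => le_ciInf fun i => ?_⟩
  · have := ciInf_le (hη a) b
    beta_reduce at this
    linarith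
  · have h1 := hm (x i)
    have h2 : quadCost τ (x i) (y i) - φ (y i) ≤ ⨅ b, (quadCost τ (x i) b - φ b) :=
      le_ciInf fun b => hsup i b
    rw [hφD] at h2
    simp only [F]
    linarith

end Conull

/-! ### Projecting almost sure properties to the marginals. -/

section Marginals

variable {X Y : Type*} [MeasurableSpace X] [MeasurableSpace Y]

/-- Disintegration gives the property almost surely on almost every fibre, and a probability measure
cannot live on an empty set. Measurability of the projected set is never needed. -/
lemma ae_exists_of_ae_fst [StandardBorelSpace Y] [Nonempty Y] {ν : Measure (X × Y)}
    [IsFiniteMeasure ν] {P : X × Y → Prop} (hP : ∀ᵐ p ∂ν, P p) :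
    ∀ᵐ x ∂(ν.map Prod.fst), ∃ y, P (x, y) := by
  have h1 : ∀ᵐ p ∂(ν.fst.compProd ν.condKernel), P p := by rwa [ν.disintegrate]
  filter_upwards [Measure.ae_ae_of_ae_compProd h1] with x hx
  exact hx.exists

lemma ae_exists_of_ae_snd [StandardBorelSpace X] [Nonempty X] {ν : Measure (X × Y)}
    [IsFiniteMeasure ν] {P : X × Y → Prop} (hP : ∀ᵐ p ∂ν, P p) :
    ∀ᵐ y ∂(ν.map Prod.snd), ∃ x, P (x, y) := by
  have h1 : ∀ᵐ p ∂(ν.map Prod.swap), P p.swap := by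
    obtain ⟨T, hT, hTm, hTP⟩ := hP.exists_measurable_mem
    filter_upwards [(ae_map_iff measurable_swap.aemeasurable (measurable_swap hTm)).2
      (show ∀ᵐ p ∂ν, p.swap.swap ∈ T by simpa using hT)] with p hp using hTP _ hp
  have h2 := ae_exists_of_ae_fst h1
  rwa [Measure.map_map measurable_fst measurable_swap] at h2

end Marginals

/-! ### Optimality implies the existence of a potential. -/

section Necessity

variable {d : ℕ} {G : Type*} [Fintype G] [MeasurableSpace G] {K : G → G → ℝ} {W : E d → ℝ} {τ : ℝ}
  {μ σ : Measure (E d × G)} {γ : G → Measure (E d × E d)} {h : E d → G → G → ℝ}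

/-- An optimal pair has potentials. -/
theorem exists_arePotentials (hK : IsConnectedWeightedGraph K) (hW : Measurable W) (hτ : 0 < τ)
    (hμ : IsP2 μ) (hσ : IsP2 σ) (hac : ∀ g, (γ g).map Prod.snd ≪ volume)
    (hac₁ : ∀ g, volume ≪ (γ g).map Prod.fst) (hac₂ : ∀ g, volume ≪ (γ g).map Prod.snd)
    (hadm : IsAdmissible K W τ μ σ γ h)
    (hopt : ∀ γ' h', IsAdmissible K W τ μ σ γ' h' →
      realCost K W τ γ h ≤ realCost K W τ γ' h') :
    ∃ φ : E d → G → ℝ, ArePotentials K τ γ h φ φ := by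
  have := hμ.prob
  have := fun g => hadm.isFiniteMeasure g
  have hdiag : ∀ y g, h y g g = 0 := fun y g => by
    have := hadm.antisymm y g g; linarith
  have hmeas : ∀ a b, 0 < K a b → AEMeasurable (fun x => h x a b) volume := by
    intro a b hab
    refine (hadm.memLp a b).aestronglyMeasurable.aemeasurable.mono_ac ?_
    refine withDensity_absolutelyContinuous' (by fun_prop) (Filter.Eventually.of_forall fun x => ?_)
    have : 0 < K a b * Real.exp (-W x) := by positivity
    simpa using this
  have hgood : ∀ g, ∀ᵐ p ∂(γ g), p ∈ goodPoints K h (γ g) := fun g =>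
    ae_mem_goodPoints hmeas (hac g)
  set Y : Set (E d) := {y | ∀ g, ∃ x, (x, y) ∈ goodPoints K h (γ g)} with hY
  have hYae : ∀ᵐ y, y ∈ Y := ae_all_iff.2 fun g => (hac₂ g).ae_le (ae_exists_of_ae_snd (hgood g))
  -- The nodes are good points with their layer, restricted to targets that are reached by good
  -- points in all layers, so that different layers can be compared over one `y`.
  let V : Type _ := {v : (E d × E d) × G // v.1 ∈ goodPoints K h (γ v.2) ∧ v.1.2 ∈ Y}
  have hnode : ∀ y ∈ Y, ∀ g, ∃ v : V, v.1.1.2 = y ∧ v.1.2 = g := by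
    intro y hy g
    obtain ⟨x, hx⟩ := hy g
    exact ⟨⟨((x, y), g), hx, hy⟩, rfl, rfl⟩
  obtain ⟨y₀, hy₀⟩ := hYae.exists
  let edge : V → V → Prop := fun v v' => v.1.2 = v'.1.2 ∨ 0 < K v.1.2 v'.1.2
  let w : V → V → ℝ := fun v v' => quadCost τ v.1.1.1 v'.1.1.2 - quadCost τ v.1.1.1 v.1.1.2 +
    h v'.1.1.2 v.1.2 v'.1.2
  have hconn : ∀ a b : V, Relation.TransGen edge a b := by
    intro a b
    have key : ∀ g, Relation.ReflTransGen (fun a b => 0 < K a b) a.1.2 g →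
        ∀ b : V, b.1.2 = g → Relation.TransGen edge a b := by
      intro g hg
      induction hg with
      | refl => exact fun b hb => .single (Or.inl hb.symm)
      | @tail g₁ g₂ _ h12 ih =>
        intro b hb
        obtain ⟨u, -, hu⟩ := hnode y₀ hy₀ g₁
        refine (ih u hu).tail (Or.inr ?_)
        rw [hu, hb]
        exact h12
    exact key _ (hK.connected _ _) b rfl
  obtain ⟨D, hD⟩ := exists_feasible_potential (edge := edge) (w := w) (fun n f hf hf0 => by
    -- A closed walk with `n + 1` nodes is a cyclic rearrangement under the rotation of `Fin (n +
    -- 1)`.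
    have hnext : ∀ i : Fin n, finRotate (n + 1) i.castSucc = i.succ := fun i => by
      rw [finRotate_apply]; simp
    have := cyclic_nonneg hK hW hτ hμ hσ hac hadm hopt (finRotate (n + 1))
      (fun i => (f i).1.2) (fun i => (f i).1.1) (fun i => (f i).2.1) (fun i => by
        induction i using Fin.lastCases with
        | last => simpa using hf0
        | cast i => simpa [hnext] using hf i i.2)
    rw [Fin.sum_univ_castSucc] at this
    simp only [hnext, finRotate_last, Fin.val_castSucc, Fin.val_succ, Fin.val_last,
      Fin.val_zero] at this
    rwa [← Fin.sum_univ_eq_sum_range (fun i => w (f i) (f (i + 1)))]) hconn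
  have hφ : ∀ g, ∃ φ : E d → ℝ, IsCConcave (quadCost τ) φ ∧
      (∀ v : {v : V // v.1.2 = g}, φ v.1.1.1.2 = D v.1) ∧
      ∀ v : {v : V // v.1.2 = g}, (v.1.1.1.1, v.1.1.1.2) ∈ cSuperdiff (quadCost τ) φ := by
    intro g
    refine exists_cConcave_of_feasible τ (x := fun v : {v : V // v.1.2 = g} => v.1.1.1.1)
      (y := fun v => v.1.1.1.2) (D := fun v => D v.1) ?_ ?_ ?_
    · rintro ⟨i, hi⟩ ⟨j, hj⟩
      -- Inside a layer the term with `h` vanishes, leaving the classical inequality for a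
      -- `c`-concave potential.
      have := hD i j (Or.inl (hi.trans hj.symm))
      simp only [w, hi, hj, hdiag, add_zero] at this
      exact this
    · have h1 : ∀ᵐ p ∂(γ g), p ∈ goodPoints K h (γ g) ∧ p.2 ∈ Y :=
        (hgood g).and (ae_of_ae_map measurable_snd.aemeasurable ((hac g).ae_le hYae))
      filter_upwards [(hac₁ g).ae_le (ae_exists_of_ae_fst h1)] with x hx
      obtain ⟨y, hy1, hy2⟩ := hx
      exact ⟨⟨⟨((x, y), g), hy1, hy2⟩, rfl⟩, rfl⟩
    · filter_upwards [hYae] with y hy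
      obtain ⟨v, hv1, hv2⟩ := hnode y hy g
      exact ⟨⟨v, hv2⟩, hv1⟩
  choose φ hφc hφD hφs using hφ
  refine ⟨fun y g => φ g y, hφc, fun g => ?_, ?_, ?_⟩
  · change ∀ᵐ p ∂(γ g), p ∈ cSuperdiff (quadCost τ) (φ g)
    filter_upwards [hgood g, ae_of_ae_map measurable_snd.aemeasurable ((hac g).ae_le hYae)]
      with p hp1 hp2
    exact hφs g ⟨⟨(p, g), hp1, hp2⟩, rfl⟩
  · filter_upwards [hYae] with y hy g g' hgg
    -- Two nodes over the same target have no difference in transport cost. Applying this in both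
    -- directions, with `h` antisymmetric, gives equality.
    have key : ∀ a b, 0 < K a b → φ b y ≤ φ a y + h y a b := by
      intro a b hab
      obtain ⟨u, hu1, hu2⟩ := hnode y hy a
      obtain ⟨v, hv1, hv2⟩ := hnode y hy b
      have h1 := hφD a ⟨u, hu2⟩
      have h2 := hφD b ⟨v, hv2⟩
      have h3 := hD u v (Or.inr (by rw [hu2, hv2]; exact hab))
      simp only [w, hu1, hu2, hv1, hv2, sub_self, zero_add] at h1 h2 h3
      rwa [← h1, ← h2] at h3
    have h1 := key g g' hgg
    have h2 := key g' g (by rw [hK.symm]; exact hgg)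
    have h3 := hadm.antisymm y g g'
    linarith
  · rw [sub_self]; exact zero_mem_phiPerp

end Necessity

end SemiDiscreteOT

end

theorem proposition4p4 {d : ℕ} {G : Type*} [Fintype G] [MeasurableSpace G]
    [DiscreteMeasurableSpace G] (K : G → G → ℝ)
    (hK : SemiDiscreteOT.IsConnectedWeightedGraph K)
    (W : SemiDiscreteOT.E d → ℝ) (hW : Measurable W) (τ : ℝ) (hτ : 0 < τ)
    (μ σ : Measure (SemiDiscreteOT.E d × G))
    (hμ : SemiDiscreteOT.IsP2 μ) (hσ : SemiDiscreteOT.IsP2 σ)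
    (hμac : μ ≪ (volume : Measure (SemiDiscreteOT.E d)).prod Measure.count)
    (hσac : σ ≪ (volume : Measure (SemiDiscreteOT.E d)).prod Measure.count)
    (hfin : SemiDiscreteOT.staticCost K W τ μ σ < ⊤)
    (γ : G → Measure (SemiDiscreteOT.E d × SemiDiscreteOT.E d))
    (h : SemiDiscreteOT.E d → G → G → ℝ)
    (hadm : SemiDiscreteOT.IsAdmissible K W τ μ σ γ h)
    (hμpos : ∀ g, ∀ᵐ x, 0 < SemiDiscreteOT.density μ g x)
    (hfpos : ∀ g, ∀ᵐ x, 0 < SemiDiscreteOT.transportedDensity K W τ σ h g x) :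
    List.TFAE [
      ∀ (γ' : G → Measure (SemiDiscreteOT.E d × SemiDiscreteOT.E d))
        (h' : SemiDiscreteOT.E d → G → G → ℝ),
        SemiDiscreteOT.IsAdmissible K W τ μ σ γ' h' →
          SemiDiscreteOT.pairCost K W τ γ h ≤ SemiDiscreteOT.pairCost K W τ γ' h',
      ∃ φ ψ : SemiDiscreteOT.E d → G → ℝ, SemiDiscreteOT.ArePotentials K τ γ h φ ψ,
      ∃ φ : SemiDiscreteOT.E d → G → ℝ, SemiDiscreteOT.ArePotentials K τ γ h φ φ] := by
  have := hμ.prob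
  have := hσ.prob
  have hfib : ∀ g, SemiDiscreteOT.fiber σ g ≪ volume := fun g =>
    SemiDiscreteOT.fiber_absolutelyContinuous hσac g
  have hfibμ : ∀ g, SemiDiscreteOT.fiber μ g ≪ volume := fun g =>
    SemiDiscreteOT.fiber_absolutelyContinuous hμac g
  have hsnd := fun g => hadm.map_snd_eq (hfib g)
  tfae_have 3 → 2 := fun ⟨φ, hφ⟩ => ⟨φ, φ, hφ⟩
  tfae_have 2 → 3 := fun ⟨φ, ψ, hφψ⟩ => hφψ.exists_single
  tfae_have 3 → 1 := by
    rintro ⟨φ, hφ⟩ γ' h' hadm'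
    rw [hadm.pairCost_eq hK hW hτ hμ hσ, hadm'.pairCost_eq hK hW hτ hμ hσ]
    exact ENNReal.ofReal_le_ofReal (hφ.realCost_le hK hW hτ hμ hσ hfib hadm hadm')
  tfae_have 1 → 3 := by
    intro hopt
    refine SemiDiscreteOT.exists_arePotentials hK hW hτ hμ hσ (fun g => ?_) (fun g => ?_)
      (fun g => ?_) hadm fun γ' h' hadm' => ?_
    · rw [hsnd]
      exact withDensity_absolutelyContinuous _ _
    · rw [hadm.fst_marginal, ← SemiDiscreteOT.withDensity_density (hfibμ g)]
      refine withDensity_absolutelyContinuous'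
        (SemiDiscreteOT.measurable_density μ g).ennreal_ofReal.aemeasurable ?_
      filter_upwards [hμpos g] with x hx
      simpa using hx
    · rw [hsnd]
      refine withDensity_absolutelyContinuous' (SemiDiscreteOT.integrable_transportedDensity hadm
        g).aestronglyMeasurable.aemeasurable.ennreal_ofReal ?_
      filter_upwards [hfpos g] with x hx
      simpa using hx
    · have := hopt γ' h' hadm'
      rwa [hadm.pairCost_eq hK hW hτ hμ hσ, hadm'.pairCost_eq hK hW hτ hμ hσ,
        ENNReal.ofReal_le_ofReal_iff (SemiDiscreteOT.realCost_nonneg hK hτ)] at this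
  tfae_finish
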